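/- The following is a theorem of ZF (Zermelo–Fraenkel set theory without the axiom of choice); that is, it holds in every model of ZF. Let $\kappa\in \mathrm{On}$ be an infinite cardinal (an infinite initial ordinal), and let $\kappa^+$ be the least cardinal in $\mathrm{On}$ greater than $\kappa$ (it exists). Then the following statements are equivalent: (i) $\mathrm{cf}(\kappa^+)=\kappa^+$; (ii) if $T\subseteq \mathrm{On}^{<\omega}$ is a tree (a set of finite sequences of ordinals closed under initial segments) such that $|\{\alpha\in \mathrm{On}: s^\frown\alpha\in T\}|<\kappa^+$ for each $s\in T$, then $|T|\le\kappa$; (iii) $\mathrm{Regressive}(\kappa^+,\kappa^+)$: for each function $f:\kappa^+\to\kappa^+$ such that $f(\alpha)<\alpha$ for all $0<\alpha<\kappa^+$, there is $\alpha<\kappa^+$ with $|f^{-1}\{\alpha\}|\ge\kappa^+$; (iv) every family $\mathcal A$ of finite sets of ordinals with $|\mathcal A|=\kappa^+$ contains a $\Delta$-system $\mathcal B\subseteq\mathcal A$ with $|\mathcal B|=\kappa^+$ (a $\Delta$-system is a family for which there is a set $r$ with $A\cap B=r$ for any two distinct members $A,B$). Moreover, (i) implies (v) $\kappa^+\to(\kappa^+,\omega+1)^2$: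 for every $f:[\kappa^+]^2\to\{0,1\}$ there is a subset of $\kappa^+$ that is either homogeneous for $f$ in colour $0$ and of order type $\kappa^+$, or homogeneous for $f$ in colour $1$ and of order type $\omega+1$; and (v) implies (vi) $\mathrm{cf}(\kappa^+)>\omega$. In particular, for $\kappa=\omega$ the following are equivalent: $\mathrm{cf}(\omega_1)=\omega_1$; $\omega_1\to(\omega_1,\omega+1)^2$; $\mathrm{Regressive}(\omega_1,\omega_1)$; and every family of $\omega_1$ finite sets of ordinals contains a $\Delta$-system of size $\omega_1$. -/

import Mathlib

namespace ZFModel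

/-! ### The language of set theory and models of ZF -/

/-- The only non-logical symbol of the language of set theory: binary membership. -/
inductive SetRel : ℕ → Type
  | mem : SetRel 2

/-- The first-order language of set theory. -/
def LSet : FirstOrder.Language := ⟨fun _ => Empty, SetRel⟩

universe u

variable {M : Type u} [LSet.Structure M]

/-- The interpretation of the membership symbol in the structure `M`. -/
def Mem (x y : M) : Prop :=
  FirstOrder.Language.Structure.RelMap (L := LSet) SetRel.mem ![x, y]

infix:50 " ∈ᴹ " => Mem

/-- `x` is the empty set. -/
def IsEmptySet (x : M) : Prop := ∀ y, ¬ y ∈ᴹ x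

/-- `x ⊆ y`. -/
def Incl (x y : M) : Prop := ∀ z, z ∈ᴹ x → z ∈ᴹ y

/-- `z = {x, y}`. -/
def IsUPair (z x y : M) : Prop := ∀ t, t ∈ᴹ z ↔ t = x ∨ t = y

/-- `y = x ∪ {x}`. -/
def IsSucc (x y : M) : Prop := ∀ t, t ∈ᴹ y ↔ t ∈ᴹ x ∨ t = x

/-- `M` is a model of Zermelo–Fraenkel set theory ZF (without the axiom of choice). The two axiom
schemes range over the classes and class relations which are first-order definable in
`(M, ∈ᴹ)` with parameters from `M`. -/
structure ModelsZF (M : Type u) [LSet.Structure M] : Prop where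
  extensionality : ∀ x y : M, (∀ z, z ∈ᴹ x ↔ z ∈ᴹ y) → x = y
  foundation : ∀ x : M, (∃ y, y ∈ᴹ x) → ∃ y, y ∈ᴹ x ∧ ∀ z, z ∈ᴹ y → ¬ z ∈ᴹ x
  pairing : ∀ x y : M, ∃ z, IsUPair z x y
  union : ∀ x : M, ∃ u, ∀ z, z ∈ᴹ u ↔ ∃ y, y ∈ᴹ x ∧ z ∈ᴹ y
  powerset : ∀ x : M, ∃ p, ∀ z, z ∈ᴹ p ↔ Incl z x
  infinity : ∃ w : M, (∃ e, e ∈ᴹ w ∧ IsEmptySet e) ∧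
    ∀ x, x ∈ᴹ w → ∃ y, y ∈ᴹ w ∧ IsSucc x y
  separation : ∀ P : Set M, (Set.univ : Set M).Definable₁ LSet P →
    ∀ a : M, ∃ b, ∀ x, x ∈ᴹ b ↔ x ∈ᴹ a ∧ x ∈ P
  replacement : ∀ F : Set (M × M), (Set.univ : Set M).Definable₂ LSet F →
    ∀ a : M, (∀ x, x ∈ᴹ a → ∀ y y', (x, y) ∈ F → (x, y') ∈ F → y = y') →
    ∃ b, ∀ y, y ∈ᴹ b ↔ ∃ x, x ∈ᴹ a ∧ (x, y) ∈ F

/-! All notions below are the usual set-theoretic ones, relativized to `M`: every quantifier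
ranges over elements of `M`, so that each of them is expressed by a first-order formula of the
language of set theory. In particular "function", "finite", "ordinal", "cardinal" and "sequence"
are meant in the sense of `M`. -/

/-! ### Pairs, functions, comparison of cardinalities -/

/-- `p` is the Kuratowski ordered pair `(x, y) = {{x}, {x, y}}`. -/
def IsPair (p x y : M) : Prop := ∀ z, z ∈ᴹ p ↔ IsUPair z x x ∨ IsUPair z x y

/-- `(x, y) ∈ f`. -/
def Maps (f x y : M) : Prop := ∃ p, IsPair p x y ∧ p ∈ᴹ f

/-- `f` is a function from `X` to `Y`. -/
def IsFun (f X Y : M) : Prop :=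
  (∀ p, p ∈ᴹ f → ∃ x y, x ∈ᴹ X ∧ y ∈ᴹ Y ∧ IsPair p x y) ∧ ∀ x, x ∈ᴹ X → ∃! y, Maps f x y

/-- `f` is an injective function from `X` to `Y`. -/
def IsInj (f X Y : M) : Prop :=
  IsFun f X Y ∧ ∀ x x' y, Maps f x y → Maps f x' y → x = x'

/-- `f` is a bijection from `X` onto `Y`. -/
def IsBij (f X Y : M) : Prop := IsInj f X Y ∧ ∀ y, y ∈ᴹ Y → ∃ x, Maps f x y

/-- `|X| = |Y|`. -/
def CardEq (X Y : M) : Prop := ∃ f, IsBij f X Y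

/-- `|X| ≤ |Y|`. -/
def CardLE (X Y : M) : Prop := ∃ f, IsInj f X Y

/-- `|X| < |Y|`. -/
def CardLT (X Y : M) : Prop := CardLE X Y ∧ ¬ CardEq X Y

/-! ### Ordinals and cardinals -/

/-- `x` is a (von Neumann) ordinal: a transitive set totally ordered by membership
(well-foundedness of membership is an axiom of ZF). -/
def IsOrd (x : M) : Prop :=
  (∀ y, y ∈ᴹ x → Incl y x) ∧ ∀ y z, y ∈ᴹ x → z ∈ᴹ x → y ∈ᴹ z ∨ y = z ∨ z ∈ᴹ y

/-- `n` is a natural number: an ordinal such that each of its elements, and itself, is zero or a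
successor. -/
def IsNat (n : M) : Prop :=
  IsOrd n ∧ ∀ m, m = n ∨ m ∈ᴹ n → IsEmptySet m ∨ ∃ k, IsSucc k m

/-- `w = ω`. -/
def IsOmega (w : M) : Prop := ∀ n, n ∈ᴹ w ↔ IsNat n

/-- `x` is a finite set. -/
def IsFinite (x : M) : Prop := ∃ n, IsNat n ∧ CardEq x n

/-- `c` is a cardinal in `On`, i.e. an initial ordinal. -/
def IsCard (c : M) : Prop := IsOrd c ∧ ∀ a, a ∈ᴹ c → ¬ CardEq a c

/-- `c` is an infinite cardinal in `On`. -/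
def IsInfCard (c : M) : Prop := IsCard c ∧ ¬ IsFinite c

/-- `m = c⁺`: `m` is the least cardinal in `On` greater than `c`. -/
def IsSuccCard (c m : M) : Prop :=
  IsCard m ∧ c ∈ᴹ m ∧ ∀ d, IsCard d → c ∈ᴹ d → m = d ∨ m ∈ᴹ d

/-- There is a function from the ordinal `b` to the ordinal `a` with range cofinal in `a`. -/
def HasCofinalMap (a b : M) : Prop :=
  ∃ f, IsFun f b a ∧ ∀ x, x ∈ᴹ a → ∃ i y, Maps f i y ∧ (x = y ∨ x ∈ᴹ y)

/-- `cf(a) = b`: `b` is the least ordinal admitting a cofinal map to `a`. -/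
def IsCof (a b : M) : Prop :=
  IsOrd b ∧ HasCofinalMap a b ∧ ∀ d, d ∈ᴹ b → ¬ HasCofinalMap a d

/-! ### Trees of finite sequences of ordinals -/

/-- `s` is a sequence of ordinals of length `n`, where `n` is a natural number. -/
def IsOrdSeq (s n : M) : Prop :=
  IsNat n ∧ (∀ p, p ∈ᴹ s → ∃ i a, i ∈ᴹ n ∧ IsOrd a ∧ IsPair p i a) ∧
    ∀ i, i ∈ᴹ n → ∃! a, Maps s i a

/-- `s ∈ On^{<ω}`. -/
def IsFinOrdSeq (s : M) : Prop := ∃ n, IsOrdSeq s n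

/-- `t = s⌢a`, the extension of the finite sequence `s` by the one further term `a`. -/
def IsAppend (s a t : M) : Prop :=
  ∃ n p, IsOrdSeq s n ∧ IsPair p n a ∧ ∀ q, q ∈ᴹ t ↔ q ∈ᴹ s ∨ q = p

/-- `T ⊆ On^{<ω}` is a tree, i.e. closed under initial segments. (A finite sequence is an initial
segment of another one exactly when it is included in it.) -/
def IsTree (T : M) : Prop :=
  (∀ t, t ∈ᴹ T → IsFinOrdSeq t) ∧ ∀ t s, t ∈ᴹ T → IsFinOrdSeq s → Incl s t → s ∈ᴹ T

/-- `T` is `<c`-branching: `|{a ∈ On : s⌢a ∈ T}| < c` for each `s ∈ T`. -/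
def IsBranchingLT (T c : M) : Prop :=
  ∀ s, s ∈ᴹ T → ∃ B, (∀ a, a ∈ᴹ B ↔ IsOrd a ∧ ∃ t, t ∈ᴹ T ∧ IsAppend s a t) ∧ CardLT B c

/-- Every `<c`-branching tree of finite sequences of ordinals has size at most `d`. -/
def TreeBound (c d : M) : Prop := ∀ T, IsTree T → IsBranchingLT T c → CardLE T d

/-! ### Regressive functions -/

/-- `f` is a regressive function from `m` to `m`: `f(a) < a` whenever `0 < a < m`. -/
def IsRegressive (f m : M) : Prop :=
  IsFun f m m ∧ ∀ a b, Maps f a b → ¬ IsEmptySet a → b ∈ᴹ a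

/-- `Regressive(m, l)`: for each regressive `f : m → m` there is `a < m` with
`|f⁻¹{a}| ≥ l`. -/
def Regressive (m l : M) : Prop :=
  ∀ f, IsRegressive f m → ∃ a, a ∈ᴹ m ∧ ∃ B, (∀ x, x ∈ᴹ B ↔ Maps f x a) ∧ CardLE l B

/-! ### Δ-systems -/

/-- `B` is a Δ-system: for some `r`, any two distinct members of `B` have intersection `r`. -/
def IsDeltaSystem (B : M) : Prop :=
  ∃ r, ∀ x y, x ∈ᴹ B → y ∈ᴹ B → x ≠ y → ∀ z, z ∈ᴹ r ↔ z ∈ᴹ x ∧ z ∈ᴹ y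

/-- `[m]^{<ω} → Δ(l)`: every family of size `m` of finite sets of ordinals contains a Δ-system
of size `l`. -/
def DeltaArrow (m l : M) : Prop :=
  ∀ A, (∀ x, x ∈ᴹ A → IsFinite x ∧ ∀ a, a ∈ᴹ x → IsOrd a) → CardEq A m →
    ∃ B, Incl B A ∧ IsDeltaSystem B ∧ CardEq B l

/-! ### The ordinary partition relation for pairs and two colours -/

/-- `D = [m]²`, the set of two-element subsets of `m`. -/
def IsPairsOf (D m : M) : Prop :=
  ∀ p, p ∈ᴹ D ↔ ∃ x y, x ∈ᴹ m ∧ y ∈ᴹ m ∧ x ≠ y ∧ IsUPair p x y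

/-- `i = 1`, i.e. `i = {∅}`. -/
def IsOne (i : M) : Prop := ∃ e, IsEmptySet e ∧ IsSucc e i

/-- `f` is a function from `[m]²` to `2 = {0, 1}`. -/
def IsColoring (f m : M) : Prop :=
  ∃ D C, IsPairsOf D m ∧ (∀ i, i ∈ᴹ C ↔ IsEmptySet i ∨ IsOne i) ∧ IsFun f D C

/-- `H` is homogeneous for the colouring `f` in the colour `i`. -/
def IsHomogeneous (f H i : M) : Prop :=
  ∀ x y, x ∈ᴹ H → y ∈ᴹ H → x ≠ y → ∃ p, IsUPair p x y ∧ Maps f p i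

/-- The set of ordinals `H` has order type `a`: there is an order isomorphism from `a`
onto `H`. -/
def HasOrderType (H a : M) : Prop :=
  ∃ g, IsBij g a H ∧ ∀ i j x y, Maps g i x → Maps g j y → i ∈ᴹ j → x ∈ᴹ y

/-- `m → (a, b)²`: for every `f : [m]² → 2` there is a subset of `m` which is homogeneous in
colour `0` and of order type `a`, or homogeneous in colour `1` and of order type `b`. -/
def Arrow (m a b : M) : Prop :=
  ∀ f, IsColoring f m → ∃ H, Incl H m ∧
    ((HasOrderType H a ∧ ∃ i, IsEmptySet i ∧ IsHomogeneous f H i) ∨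
      (HasOrderType H b ∧ ∃ i, IsOne i ∧ IsHomogeneous f H i))

end ZFModel

/-!
The proof takes place inside an arbitrary model `M` of ZF. Separation and replacement are available
only for definable classes, so definability with parameters is made a type class (`Def`, `DefF`, …)
which instance search verifies. The usual operations of set theory then become functions on `M`,
and arguments of ordinary set theory can be carried out literally, with `sep`, `image` and `lam` as
comprehension principles. The successor cardinal `μ = κ⁺` is the Hartogs number of `κ`; its
elements are the ordinals which inject into `κ`.

A choice-free substitute for the regularity arguments of ZFC is the following pigeonhole principle
(`Reg.bounded_union`, `Unb.pigeonhole`): if `cf(μ) = μ` and an unbounded subset of `μ` is divided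
into at most `κ` pieces, then one piece is unbounded. Bounds for the pieces need not be chosen, as
least bounds exist. Unbounded subsets of a regular `μ` have order type `μ` because sets of ordinals
can be collapsed.

* Regressive functions (`Reg.exists_unb_fibre`): if all fibres are bounded, then closing off `ω`
  times under bounds for the fibres yields an ordinal `δ < μ` such that `f⁻¹{α} ⊆ δ` for all
  `α < δ`. Then `f(δ) < δ` is impossible.
* Trees (`Reg.treeBound`): sequences of ordinals are well-ordered by length and lexicographically,
  so a tree which is too large has `μ` distinct nodes, and by pigeonhole `μ` of the same length. A
  longest node below unboundedly many of them can be extended by pigeonhole, a contradiction.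
* Delta-systems (`Reg.deltaArrow`): for a root with the least possible number of elements outside
  it, no further point lies in unboundedly many members, and a regressive function gives
  unboundedly many members pairwise disjoint outside the root.
* The partition relation (`Reg.arrow`): to every `α` a greedy set `G(α) ⊆ α` is attached. If it is
  infinite for some `α` there is a homogeneous set of type `ω + 1`; otherwise `G` is constant on an
  unbounded set by `Reg.exists_unb_const`, a form of the regressive function property for finite
  sets.

Conversely, if `μ` is singular, a cofinal map gives an index function on `μ` with fewer than `μ`
values and bounded fibres (`exists_index_of_not_reg`), which refutes the tree bound, the regressive
function property and the Delta-system property. If the cofinality is at most `ω`, colouring pairs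
by whether their indices differ refutes `μ → (μ, ω + 1)²` (`Arrow.not_hasCofinalMap`).
-/

namespace ZFModel

open FirstOrder

universe u

/-! ### Definability with parameters -/

section Definability

variable {M : Type u} [LSet.Structure M]

/-- Prepend `x` to the assignment `v`. -/
def push (x : M) (v : ℕ → M) : ℕ → M
  | 0 => x
  | i + 1 => v i

/-- The predicate `P` on assignments of the variables `0, 1, 2, …` is first-order definable with
parameters. It is a class, with one instance for each logical connective, quantifier and definable
notion, so that instance search carries out the recursion over the shape of `P`. A quantifier is
removed by renaming the bound variable to `0` and shifting the others, as with de Bruijn indices. -/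
class Def (P : (ℕ → M) → Prop) : Prop where
  out : ∃ φ : (LSet[[(Set.univ : Set M)]]).Formula ℕ, ∀ v, φ.Realize v ↔ P v

/-- The graph of the function `t` on assignments is first-order definable with parameters: the value
is the variable `0` and the arguments are shifted by one. -/
class DefF (t : (ℕ → M) → M) : Prop where
  out : Def fun v => v 0 = t fun i => v (i + 1)

/-- A definable predicate. -/
class DefRel₁ (R : M → Prop) : Prop where
  out : Def fun v => R (v 0)

/-- A definable binary relation. -/
class DefRel₂ (R : M → M → Prop) : Prop where
  out : Def fun v => R (v 0) (v 1)

/-- A definable ternary relation. -/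
class DefRel₃ (R : M → M → M → Prop) : Prop where
  out : Def fun v => R (v 0) (v 1) (v 2)

/-- A definable unary function. -/
class DefFun₁ (F : M → M) : Prop where
  out : DefF fun v => F (v 0)

/-- A definable binary function. -/
class DefFun₂ (F : M → M → M) : Prop where
  out : DefF fun v => F (v 0) (v 1)

theorem Def.congr {P Q : (ℕ → M) → Prop} (h : Def P) (e : ∀ v, Q v ↔ P v) : Def Q :=
  ⟨h.out.imp fun _ hφ v => (hφ v).trans (e v).symm⟩

/-- Substitution of variables and parameters for the variables. -/
theorem Def.subst {P : (ℕ → M) → Prop} (h : Def P) (σ : ℕ → M ⊕ ℕ) :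
    Def fun v => P fun i => Sum.elim id v (σ i) := by
  obtain ⟨φ, hφ⟩ := h.out
  let τ : ℕ → (LSet[[(Set.univ : Set M)]]).Term ℕ := fun i =>
    Sum.elim (fun c => (LSet.con (⟨c, trivial⟩ : (Set.univ : Set M))).term)
      (fun j => Language.Term.var j) (σ i)
  refine ⟨φ.subst τ, fun v => ?_⟩
  rw [← hφ, Language.Formula.Realize, Language.BoundedFormula.realize_subst,
    Language.Formula.Realize]
  have : (fun a => (τ a).realize v) = fun i => Sum.elim id v (σ i) := by
    funext i
    rcases h : σ i with c | j <;> simp [τ, h]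
  rw [this]

theorem Def.reindex {P : (ℕ → M) → Prop} (h : Def P) (σ : ℕ → ℕ) : Def fun v => P fun i =>
    v (σ i) :=
  h.subst fun i => Sum.inr (σ i)

instance (priority := 1100) Def.and {P Q : (ℕ → M) → Prop} [hP : Def P] [hQ : Def Q] : Def fun v =>
    P v ∧ Q v := by
  obtain ⟨φ, hφ⟩ := hP.out
  obtain ⟨ψ, hψ⟩ := hQ.out
  exact ⟨φ ⊓ ψ, fun v => by rw [Language.Formula.realize_inf, hφ, hψ]⟩

instance (priority := 1100) Def.not {P : (ℕ → M) → Prop} [hP : Def P] : Def fun v => ¬ P v := by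
  obtain ⟨φ, hφ⟩ := hP.out
  exact ⟨∼φ, fun v => by rw [Language.Formula.realize_not, hφ]⟩

theorem Def.ex' {P : M → (ℕ → M) → Prop} (h : Def fun v => P (v 0) fun i => v (i + 1)) :
    Def fun v => ∃ x, P x v := by
  obtain ⟨φ, hφ⟩ := h.out
  let g : ℕ → ℕ ⊕ Fin 1 := fun i => match i with
    | 0 => Sum.inr 0
    | i + 1 => Sum.inl i
  refine ⟨(Language.BoundedFormula.relabel (n := 1) (k := 0) g φ).ex, fun v => ?_⟩
  rw [Language.Formula.Realize, Language.BoundedFormula.realize_ex]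
  refine exists_congr fun x => ?_
  rw [Language.BoundedFormula.realize_relabel]
  have := hφ (push x v)
  rw [Language.Formula.Realize] at this
  refine Iff.trans (iff_of_eq ?_) this
  congr 1
  · funext i
    rcases i with _ | i <;> simp [g, push, Fin.snoc]
  · exact Subsingleton.elim _ _

instance (priority := 1100) Def.ex {P : M → (ℕ → M) → Prop} [h : Def fun v => P (v 0) fun i =>
    v (i + 1)] :
    Def fun v => ∃ x, P x v := Def.ex' h

instance (priority := 1100) Def.all {P : M → (ℕ → M) → Prop} [h : Def fun v => P (v 0) fun i =>
    v (i + 1)] :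
    Def fun v => ∀ x, P x v :=
  have : Def fun v : ℕ → M => ¬ ∃ x, ¬ P x v := inferInstance
  this.congr fun v => by simp

instance (priority := 1100) Def.or {P Q : (ℕ → M) → Prop} [hP : Def P] [hQ : Def Q] : Def fun v =>
    P v ∨ Q v :=
  have : Def fun v : ℕ → M => ¬ (¬ P v ∧ ¬ Q v) := inferInstance
  this.congr fun v => by tauto

instance (priority := 1100) Def.imp {P Q : (ℕ → M) → Prop} [hP : Def P] [hQ : Def Q] : Def fun v =>
    P v → Q v :=
  have : Def fun v : ℕ → M => ¬ (P v ∧ ¬ Q v) := inferInstance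
  this.congr fun v => by tauto

instance (priority := 1100) Def.iff {P Q : (ℕ → M) → Prop} [hP : Def P] [hQ : Def Q] : Def fun v =>
    (P v ↔ Q v) :=
  have : Def fun v : ℕ → M => (P v → Q v) ∧ (Q v → P v) := inferInstance
  this.congr fun v => by tauto

theorem Def.var_eq (i j : ℕ) : Def fun v : ℕ → M => v i = v j :=
  ⟨(Language.Term.var i).equal (Language.Term.var j), fun v => by
    rw [Language.Formula.realize_equal]; rfl⟩

theorem Def.var_mem (i j : ℕ) : Def fun v : ℕ → M => v i ∈ᴹ v j := by
  refine ⟨Language.Relations.formula₂ (L := LSet[[(Set.univ : Set M)]])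
    (Sum.inl (SetRel.mem : LSet.Relations 2) : LSet[[(Set.univ : Set M)]].Relations 2)
    (Language.Term.var i) (Language.Term.var j), fun v => ?_⟩
  exact Language.Formula.realize_rel₂

theorem Def.var_eq_const (i : ℕ) (a : M) : Def fun v : ℕ → M => v i = a := by
  have := (Def.var_eq (M := M) 0 1).subst fun k => if k = 0 then Sum.inr i else Sum.inl a
  exact this.congr fun v => by simp

instance DefF.var (i : ℕ) : DefF fun v : ℕ → M => v i := ⟨Def.var_eq 0 (i + 1)⟩

/-- Elements of `M` occurring in a predicate are parameters of the defining formula. -/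
instance (priority := 1200) DefF.const (a : M) : DefF fun _ : ℕ → M => a := ⟨Def.var_eq_const 0 a⟩

instance (priority := 1200) Def.const (p : Prop) : Def fun _ : ℕ → M => p := by
  by_cases hp : p
  · exact (Def.var_eq (M := M) 0 0).congr fun v => by simp [hp]
  · exact ⟨⊥, fun v => by simp [hp]⟩

/-- Substitution of a definable term for the variable `0`: since terms are given by their graphs,
this is `∃ x, x = t ∧ P x`. -/
theorem Def.instantiate {P : M → (ℕ → M) → Prop} (h : Def fun v => P (v 0) fun i => v (i + 1))
    {t : (ℕ → M) → M} (ht : DefF t) : Def fun v => P (t v) v := by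
  have := ht.out
  have : Def fun v : ℕ → M => ∃ x, x = t v ∧ P x v := Def.ex' Def.and
  exact this.congr fun v => by simp

instance (priority := 900) DefRel₁.comp {R : M → Prop} [h : DefRel₁ R] {t : (ℕ → M) → M} [ht :
    DefF t] :
    Def fun v => R (t v) :=
  Def.instantiate (P := fun x _ => R x) h.out ht

instance (priority := 910) DefRel₂.comp {R : M → M → Prop} [h : DefRel₂ R] {t s : (ℕ → M) → M} [ht :
    DefF t]
    [hs : DefF s] : Def fun v => R (t v) (s v) := by
  refine Def.instantiate (P := fun x v => R x (s v)) ?_ ht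
  have hs' : DefF fun v : ℕ → M => s fun i => v (i + 1) :=
    ⟨hs.out.reindex fun i => if i = 0 then 0 else i + 1⟩
  refine Def.instantiate (P := fun y v => R (v 0) y) ?_ hs'
  exact h.out.reindex fun i => if i = 0 then 1 else 0

theorem DefF.shift {s : (ℕ → M) → M} (hs : DefF s) : DefF fun v : ℕ → M => s fun i => v (i + 1) :=
  ⟨hs.out.reindex fun i => if i = 0 then 0 else i + 1⟩

instance (priority := 920) DefRel₃.comp {R : M → M → M → Prop} [h : DefRel₃ R] {t s r : (ℕ → M) → M}
    [ht : DefF t] [hs : DefF s] [hr : DefF r] : Def fun v => R (t v) (s v) (r v) := by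
  refine Def.instantiate (P := fun x v => R x (s v) (r v)) ?_ ht
  refine Def.instantiate (P := fun y v => R (v 0) y (r fun i => v (i + 1))) ?_ hs.shift
  refine Def.instantiate (P := fun z v => R (v 1) (v 0) z) ?_ hr.shift.shift
  exact h.out.reindex fun i => if i = 0 then 2 else if i = 1 then 1 else 0

instance : DefRel₂ (Mem (M := M)) := ⟨Def.var_mem 0 1⟩
instance DefRel₂.eq : DefRel₂ (fun x y : M => x = y) := ⟨Def.var_eq 0 1⟩
instance (priority := 1100) Def.eq {t s : (ℕ → M) → M} [DefF t] [DefF s] : Def fun v => t v = s v :=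
  DefRel₂.comp (R := fun x y => x = y)
instance (priority := 1100) Def.ne {t s : (ℕ → M) → M} [DefF t] [DefF s] : Def fun v => t v ≠ s v :=
  Def.not

instance (priority := 910) DefFun₁.comp {F : M → M} [h : DefFun₁ F] {t : (ℕ → M) → M} [ht :
    DefF t] :
    DefF fun v => F (t v) := by
  constructor
  refine Def.instantiate (P := fun x v => v 0 = F x) ?_ ht.shift
  exact h.out.out.reindex fun i => if i = 0 then 1 else 0

instance (priority := 910) DefFun₂.comp {F : M → M → M} [h : DefFun₂ F] {t s : (ℕ → M) → M} [ht :
    DefF t]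
    [hs : DefF s] : DefF fun v => F (t v) (s v) := by
  constructor
  refine Def.instantiate (P := fun x v => v 0 = F x (s fun i => v (i + 1))) ?_ ht.shift
  refine Def.instantiate (P := fun y v => v 1 = F (v 0) y) ?_ hs.shift.shift
  exact h.out.out.reindex fun i => if i = 0 then 2 else if i = 1 then 1 else 0

instance (priority := 1100) Def.exUnique {P : M → (ℕ → M) → Prop} [h : Def fun v => P (v 0) fun i =>
    v (i + 1)] :
    Def fun v => ∃! x, P x v := by
  have h2 : Def fun v : ℕ → M => P (v 0) fun i => v (i + 1 + 1) :=
    h.reindex fun i => if i = 0 then 0 else i + 1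
  have h3 : Def fun v : ℕ → M => ∀ y, P y (fun i => v (i + 1)) → y = v 0 := by
    apply Def.all (P := fun y v => P y (fun i => v (i + 1)) → y = v 0)
  have : Def fun v : ℕ → M => ∃ x, P x v ∧ ∀ y, P y v → y = x := Def.ex
  exact this.congr fun v => Iff.rfl

/-! The next instances prove definability of explicit lambda terms. Their low priority lets the
instances for named relations and functions come first. -/

instance (priority := 100) DefRel₁.mk' {R : M → Prop} [h : Def fun v => R (v 0)] : DefRel₁ R := ⟨h⟩
instance (priority := 100) DefRel₂.mk' {R : M → M → Prop} [h : Def fun v => R (v 0) (v 1)] :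
    DefRel₂ R :=
  ⟨h⟩
instance (priority := 100) DefFun₁.mk' {F : M → M} [h : DefF fun v => F (v 0)] : DefFun₁ F := ⟨h⟩
instance (priority := 100) DefFun₂.mk' {F : M → M → M} [h : DefF fun v => F (v 0) (v 1)] :
    DefFun₂ F :=
  ⟨h⟩

instance (priority := 1100) DefF.ite {P : (ℕ → M) → Prop} [hP : Def P] [DecidablePred P] {t s : (ℕ →
    M) → M} [ht : DefF t] [hs : DefF s] :
    DefF fun v => if P v then t v else s v := by
  constructor
  have h1 := ht.out
  have h2 := hs.out
  have h3 : Def fun v : ℕ → M => P fun i => v (i + 1) := hP.reindex _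
  have : Def fun v : ℕ → M => ((P fun i => v (i + 1)) ∧ v 0 = t fun i => v (i + 1)) ∨
    ((¬ P fun i => v (i + 1)) ∧ v 0 = s fun i => v (i + 1)) := inferInstance
  exact this.congr fun v => by split_ifs <;> tauto

theorem DefRel₁.definable {P : M → Prop} (h : DefRel₁ P) :
    (Set.univ : Set M).Definable₁ LSet {x | P x} := by
  obtain ⟨φ, hφ⟩ := h.out.out
  refine ⟨φ.relabel fun _ => 0, ?_⟩
  ext v
  simp only [Set.mem_ofPred_eq, Language.Formula.realize_relabel]
  exact (hφ fun _ => v 0).symm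

theorem DefRel₂.definable {R : M → M → Prop} (h : DefRel₂ R) :
    (Set.univ : Set M).Definable₂ LSet {p | R p.1 p.2} := by
  obtain ⟨φ, hφ⟩ := h.out.out
  refine ⟨φ.relabel fun i => if i = 0 then 0 else 1, ?_⟩
  ext v
  simp only [Set.mem_ofPred_eq, Language.Formula.realize_relabel]
  exact (hφ fun i => v (if i = 0 then 0 else 1)).symm

end Definability

/-! ### Definability of the set-theoretic notions -/

section Instances

variable {M : Type u} [LSet.Structure M]

instance : DefRel₁ (IsEmptySet (M := M)) := ⟨by unfold IsEmptySet; infer_instance⟩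
instance : DefRel₂ (Incl (M := M)) := ⟨by unfold Incl; infer_instance⟩
instance : DefRel₃ (IsUPair (M := M)) := ⟨by unfold IsUPair; infer_instance⟩
instance : DefRel₂ (IsSucc (M := M)) := ⟨by unfold IsSucc; infer_instance⟩
instance : DefRel₃ (IsPair (M := M)) := ⟨by unfold IsPair; infer_instance⟩
instance : DefRel₃ (Maps (M := M)) := ⟨by unfold Maps; infer_instance⟩
instance : DefRel₃ (IsFun (M := M)) := ⟨by unfold IsFun; infer_instance⟩
instance : DefRel₃ (IsInj (M := M)) := ⟨by unfold IsInj; infer_instance⟩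
instance : DefRel₂ (CardLE (M := M)) := ⟨by unfold CardLE; infer_instance⟩
instance : DefRel₁ (IsOrd (M := M)) := ⟨by unfold IsOrd; infer_instance⟩
instance : DefRel₁ (IsNat (M := M)) := ⟨by unfold IsNat; infer_instance⟩
instance : DefRel₂ (HasCofinalMap (M := M)) := ⟨by unfold HasCofinalMap; infer_instance⟩
instance : DefRel₂ (IsOrdSeq (M := M)) := ⟨by unfold IsOrdSeq; infer_instance⟩
instance : DefRel₃ (IsAppend (M := M)) := ⟨by unfold IsAppend; infer_instance⟩

end Instances

/-! ### Definite descriptions and elementary set formation -/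

section Basic

variable {M : Type u} [LSet.Structure M]

/-- The assumption that `M` is a model of ZF, as a class. -/
class ZF (M : Type u) [LSet.Structure M] : Prop where
  out : ModelsZF M

instance [h : ZF M] : Nonempty M := ⟨h.out.infinity.choose⟩

variable [ZF M]

open Classical in
/-- The unique `x` with `P x`, or a fixed element of `M` if there is no such unique `x`. -/
noncomputable def the (P : M → Prop) : M :=
  if h : ∃! x, P x then h.choose else Classical.arbitrary M

theorem the_spec {P : M → Prop} (h : ∃! x, P x) : P (the P) := by
  rw [the, dif_pos h]
  exact h.choose_spec.1

theorem the_eq {P : M → Prop} (h : ∃! x, P x) {x : M} (hx : P x) : the P = x :=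
  h.unique (the_spec h) hx

instance (priority := 1100) DefF.the {P : M → (ℕ → M) → Prop}
    [h : Def fun v => P (v 0) fun i => v (i + 1)] : DefF fun v => the fun x => P x v := by
  constructor
  have h1 : Def fun v : ℕ → M => ∃! x, P x v := inferInstance
  have h2 : Def fun v : ℕ → M => ∃! x, P x fun i => v (i + 1) := h1.reindex _
  have : Def fun v : ℕ → M => ((∃! x, P x fun i => v (i + 1)) ∧ P (v 0) fun i => v (i + 1)) ∨
    ((¬ ∃! x, P x fun i => v (i + 1)) ∧ v 0 = Classical.arbitrary M) := inferInstance
  refine this.congr fun v => ?_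
  by_cases hv : ∃! x, P x fun i => v (i + 1)
  · simp only [hv, true_and, not_true, false_and, or_false]
    exact ⟨fun e => e ▸ the_spec hv, fun e => (the_eq hv e).symm⟩
  · simp only [hv, not_false_eq_true, true_and, false_and, false_or, ZFModel.the, dite_false]

/-- The set of all `x` with `P x`, if they form a set. -/
noncomputable def compr (P : M → Prop) : M := the fun b => ∀ x, x ∈ᴹ b ↔ P x

instance (priority := 1100) DefF.compr {P : M → (ℕ → M) → Prop}
    [h : Def fun v => P (v 0) fun i => v (i + 1)] : DefF fun v => compr fun x => P x v := by
  unfold ZFModel.compr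
  have : Def fun v : ℕ → M => P (v 0) fun i => v (i + 1 + 1) :=
    h.reindex fun i => if i = 0 then 0 else i + 1
  apply DefF.the (M := M) (P := fun b v => ∀ x, x ∈ᴹ b ↔ P x v)

@[ext] theorem ext {x y : M} (h : ∀ z, z ∈ᴹ x ↔ z ∈ᴹ y) : x = y := ZF.out.extensionality x y h

theorem mem_compr {P : M → Prop} (h : ∃ b, ∀ x, x ∈ᴹ b ↔ P x) (x : M) :
    x ∈ᴹ compr P ↔ P x := by
  obtain ⟨b, hb⟩ := h
  exact the_spec (P := fun b => ∀ x, x ∈ᴹ b ↔ P x)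
    ⟨b, hb, fun c hc => ext fun z => (hc z).trans (hb z).symm⟩ x

/-- The set of all `x ∈ a` with `P x`. -/
noncomputable def sep (a : M) (P : M → Prop) : M := compr fun x => x ∈ᴹ a ∧ P x

instance (priority := 1100) DefF.sep {P : M → (ℕ → M) → Prop} {t : (ℕ → M) → M} [ht : DefF t]
    [h : Def fun v => P (v 0) fun i => v (i + 1)] : DefF fun v => sep (t v) fun x => P x v := by
  unfold ZFModel.sep
  have := ht.shift
  apply DefF.compr (P := fun x v => x ∈ᴹ t v ∧ P x v)

@[simp] theorem mem_sep {a : M} {P : M → Prop} [h : DefRel₁ P] {x : M} :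
    x ∈ᴹ sep a P ↔ x ∈ᴹ a ∧ P x :=
  mem_compr (ZF.out.separation _ h.definable a) x

/-- The set of all `F x` with `x ∈ a`. -/
noncomputable def image (a : M) (F : M → M) : M := compr fun y => ∃ x, x ∈ᴹ a ∧ y = F x

instance (priority := 1100) DefF.image {F : M → (ℕ → M) → M} {t : (ℕ → M) → M} [ht : DefF t]
    [h : DefF fun v => F (v 0) fun i => v (i + 1)] : DefF fun v => image (t v) fun x => F x v := by
  unfold ZFModel.image
  have := ht.shift.shift
  have : DefF fun v : ℕ → M => F (v 0) fun i => v (i + 1 + 1) :=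
    ⟨h.out.reindex fun i => if i = 0 then 0 else if i = 1 then 1 else i + 1⟩
  apply DefF.compr (P := fun y v => ∃ x, x ∈ᴹ t v ∧ y = F x v)

@[simp] theorem mem_image {a : M} {F : M → M} [h : DefFun₁ F] {y : M} :
    y ∈ᴹ image a F ↔ ∃ x, x ∈ᴹ a ∧ y = F x := by
  refine mem_compr ?_ y
  have : DefRel₂ fun x y => y = F x := inferInstance
  exact ZF.out.replacement _ this.definable a fun x _ y y' hy hy' => hy.trans hy'.symm

/-- The empty set. -/
noncomputable def emp : M := compr fun _ => False

@[simp] theorem not_mem_emp (x : M) : ¬ x ∈ᴹ emp := by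
  have : ∃ b : M, ∀ x, x ∈ᴹ b ↔ False := by
    obtain ⟨w, ⟨e, -, he⟩, -⟩ := (ZF.out (M := M)).infinity
    exact ⟨e, fun x => iff_false_intro (he x)⟩
  exact fun h => (mem_compr this x).1 h

/-- The unordered pair `{x, y}`. -/
noncomputable def upair (x y : M) : M := compr fun t => t = x ∨ t = y

/-- The Kuratowski ordered pair. -/
noncomputable def pair (x y : M) : M := upair (upair x x) (upair x y)

/-- The union of the elements of `x`. -/
noncomputable def sUnion (x : M) : M := compr fun z => ∃ y, y ∈ᴹ x ∧ z ∈ᴹ y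

/-- The power set. -/
noncomputable def power (x : M) : M := compr fun z => Incl z x

/-- The union of two sets. -/
noncomputable def union (x y : M) : M := compr fun z => z ∈ᴹ x ∨ z ∈ᴹ y

/-- The ordinal successor `x ∪ {x}`. -/
noncomputable def succ (x : M) : M := compr fun z => z ∈ᴹ x ∨ z = x

/-- The value of the function `f` at `x`. -/
noncomputable def app (f x : M) : M := the fun y => Maps f x y

/-- The cartesian product. -/
noncomputable def prod (a b : M) : M :=
  compr fun p => ∃ x y, x ∈ᴹ a ∧ y ∈ᴹ b ∧ p = pair x y

/-- The function with domain `X` given by `F`. -/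
noncomputable def lam (X : M) (F : M → M) : M := image X fun x => pair x (F x)

instance : DefFun₂ (upair (M := M)) := ⟨by unfold upair; infer_instance⟩
instance : DefFun₂ (pair (M := M)) := ⟨by unfold pair; infer_instance⟩
instance : DefFun₁ (sUnion (M := M)) := ⟨by unfold sUnion; infer_instance⟩
instance : DefFun₂ (union (M := M)) := ⟨by unfold union; infer_instance⟩
instance : DefFun₁ (succ (M := M)) := ⟨by unfold succ; infer_instance⟩
instance : DefFun₂ (app (M := M)) := ⟨by unfold app; infer_instance⟩

instance (priority := 1100) DefF.lam {F : M → (ℕ → M) → M} {t : (ℕ → M) → M} [ht : DefF t]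
    [h : DefF fun v => F (v 0) fun i => v (i + 1)] : DefF fun v => lam (t v) fun x => F x v := by
  unfold ZFModel.lam
  apply DefF.image (F := fun x v => pair x (F x v))

@[simp] theorem mem_upair {x y z : M} : z ∈ᴹ upair x y ↔ z = x ∨ z = y :=
  mem_compr (ZF.out.pairing x y) z

@[simp] theorem mem_sUnion {x z : M} : z ∈ᴹ sUnion x ↔ ∃ y, y ∈ᴹ x ∧ z ∈ᴹ y :=
  mem_compr (ZF.out.union x) z

@[simp] theorem mem_power {x z : M} : z ∈ᴹ power x ↔ Incl z x := mem_compr (ZF.out.powerset x) z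

@[simp] theorem mem_union {x y z : M} : z ∈ᴹ union x y ↔ z ∈ᴹ x ∨ z ∈ᴹ y :=
  mem_compr (P := fun z => z ∈ᴹ x ∨ z ∈ᴹ y) ⟨sUnion (upair x y), fun z => by simp⟩ z

@[simp] theorem mem_succ {x z : M} : z ∈ᴹ succ x ↔ z ∈ᴹ x ∨ z = x :=
  mem_compr (P := fun z => z ∈ᴹ x ∨ z = x) ⟨union x (upair x x), fun z => by simp⟩ z

@[simp] theorem isEmptySet_iff {x : M} : IsEmptySet x ↔ x = emp :=
  ⟨fun h => ext fun z => by simp [h z], fun h => by subst h; exact not_mem_emp⟩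

@[simp] theorem isUPair_iff {z x y : M} : IsUPair z x y ↔ z = upair x y :=
  ⟨fun h => ext fun t => by simp [h t], fun h => by subst h; exact fun t => mem_upair⟩

@[simp] theorem isSucc_iff {x y : M} : IsSucc x y ↔ y = succ x :=
  ⟨fun h => ext fun t => by simp [h t], fun h => by subst h; exact fun t => mem_succ⟩

@[simp] theorem isPair_iff {p x y : M} : IsPair p x y ↔ p = pair x y := by
  simp only [IsPair, isUPair_iff]
  exact ⟨fun h => ext fun t => by simp [h t, pair], fun h t => by subst h; simp [pair]⟩

theorem maps_iff_mem {f x y : M} : Maps f x y ↔ pair x y ∈ᴹ f := by simp [Maps]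

theorem upair_eq_iff {a b c d : M} :
    upair a b = upair c d ↔ (a = c ∧ b = d) ∨ (a = d ∧ b = c) := by
  constructor
  · intro h
    have h1 := (mem_upair (x := a) (y := b) (z := a)).2 (.inl rfl)
    have h2 := (mem_upair (x := a) (y := b) (z := b)).2 (.inr rfl)
    have h3 := (mem_upair (x := c) (y := d) (z := c)).2 (.inl rfl)
    have h4 := (mem_upair (x := c) (y := d) (z := d)).2 (.inr rfl)
    rw [h, mem_upair] at h1 h2
    rw [← h, mem_upair] at h3 h4
    grind
  · rintro (⟨rfl, rfl⟩ | ⟨rfl, rfl⟩)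
    · rfl
    · ext z; simp [or_comm]

theorem upair_comm (a b : M) : upair a b = upair b a := upair_eq_iff.2 (.inr ⟨rfl, rfl⟩)

@[simp] theorem pair_inj {a b c d : M} : pair a b = pair c d ↔ a = c ∧ b = d := by
  unfold pair
  rw [upair_eq_iff, upair_eq_iff, upair_eq_iff, upair_eq_iff, upair_eq_iff]
  grind

@[simp] theorem mem_prod {a b p : M} :
    p ∈ᴹ prod a b ↔ ∃ x y, x ∈ᴹ a ∧ y ∈ᴹ b ∧ p = pair x y :=
  mem_compr (P := fun p => ∃ x y, x ∈ᴹ a ∧ y ∈ᴹ b ∧ p = pair x y)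
    ⟨sUnion (image a fun x => image b fun y => pair x y), fun p => by
      simp only [mem_sUnion, mem_image]
      constructor
      · rintro ⟨_, ⟨x, hx, rfl⟩, hp⟩
        obtain ⟨y, hy, rfl⟩ := mem_image.1 hp
        exact ⟨x, y, hx, hy, rfl⟩
      · rintro ⟨x, y, hx, hy, rfl⟩
        exact ⟨_, ⟨x, hx, rfl⟩, mem_image.2 ⟨y, hy, rfl⟩⟩⟩ p

@[simp] theorem maps_lam {X : M} {F : M → M} [DefFun₁ F] {x y : M} :
    Maps (lam X F) x y ↔ x ∈ᴹ X ∧ y = F x := by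
  rw [maps_iff_mem, lam, mem_image]
  constructor
  · rintro ⟨x', hx, h⟩
    rw [pair_inj] at h
    exact ⟨h.1 ▸ hx, h.1 ▸ h.2⟩
  · rintro ⟨hx, rfl⟩
    exact ⟨x, hx, rfl⟩

/-! ### Functions and comparison of cardinalities -/

omit [ZF M] in
theorem incl_refl (x : M) : Incl x x := fun _ h => h

omit [ZF M] in
theorem Incl.trans {x y z : M} (h : Incl x y) (h' : Incl y z) : Incl x z := fun t ht =>
    h' t (h t ht)

theorem Incl.antisymm {x y : M} (h : Incl x y) (h' : Incl y x) : x = y :=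
  ext fun z => ⟨h z, h' z⟩

theorem IsFun.maps_iff {f X Y : M} (hf : IsFun f X Y) {x y : M} :
    Maps f x y ↔ x ∈ᴹ X ∧ y = app f x := by
  have dom : ∀ {x y}, Maps f x y → x ∈ᴹ X := by
    intro x y h
    rw [maps_iff_mem] at h
    obtain ⟨x', y', hx, hy, h'⟩ := hf.1 _ h
    simp only [isPair_iff, pair_inj] at h'
    exact h'.1 ▸ hx
  constructor
  · intro h
    exact ⟨dom h, (the_eq (hf.2 x (dom h)) h).symm⟩
  · rintro ⟨hx, rfl⟩
    exact the_spec (hf.2 x hx)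

theorem IsFun.app_mem {f X Y : M} (hf : IsFun f X Y) {x : M} (hx : x ∈ᴹ X) : app f x ∈ᴹ Y := by
  have h := hf.maps_iff.2 ⟨hx, rfl⟩
  rw [maps_iff_mem] at h
  obtain ⟨x', y', hx, hy, h'⟩ := hf.1 _ h
  simp only [isPair_iff, pair_inj] at h'
  exact h'.2 ▸ hy

theorem isFun_lam {X Y : M} {F : M → M} [DefFun₁ F] (h : ∀ x, x ∈ᴹ X → F x ∈ᴹ Y) :
    IsFun (lam X F) X Y := by
  constructor
  · intro p hp
    rw [lam, mem_image] at hp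
    obtain ⟨x, hx, rfl⟩ := hp
    exact ⟨x, F x, hx, h x hx, by simp⟩
  · intro x hx
    exact ⟨F x, by simp [hx], fun y hy => (maps_lam.1 hy).2⟩

@[simp] theorem app_lam {X : M} {F : M → M} [DefFun₁ F] {x : M} (hx : x ∈ᴹ X) :
    app (lam X F) x = F x :=
  the_eq ⟨F x, by simp [hx], fun y hy => (maps_lam.1 hy).2⟩ (maps_lam.2 ⟨hx, rfl⟩)

theorem CardLE.intro {X Y : M} (F : M → M) [DefFun₁ F] (h : ∀ x, x ∈ᴹ X → F x ∈ᴹ Y)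
    (inj : ∀ x y, x ∈ᴹ X → y ∈ᴹ X → F x = F y → x = y) : CardLE X Y :=
  ⟨lam X F, isFun_lam h, fun x x' y hx hx' => by
    rw [maps_lam] at hx hx'
    exact inj x x' hx.1 hx'.1 (hx.2.symm.trans hx'.2)⟩

theorem CardLE.elim {X Y : M} (h : CardLE X Y) : ∃ F : M → M, DefFun₁ F ∧
    (∀ x, x ∈ᴹ X → F x ∈ᴹ Y) ∧ ∀ x y, x ∈ᴹ X → y ∈ᴹ X → F x = F y → x = y := by
  obtain ⟨f, hf, inj⟩ := h
  exact ⟨app f, inferInstance, fun x hx => hf.app_mem hx, fun x y hx hy e =>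
    inj x y _ (hf.maps_iff.2 ⟨hx, rfl⟩) (hf.maps_iff.2 ⟨hy, e⟩)⟩

theorem isBij_lam {X Y : M} {F : M → M} [DefFun₁ F] (h : ∀ x, x ∈ᴹ X → F x ∈ᴹ Y)
    (inj : ∀ x y, x ∈ᴹ X → y ∈ᴹ X → F x = F y → x = y)
    (surj : ∀ y, y ∈ᴹ Y → ∃ x, x ∈ᴹ X ∧ y = F x) : IsBij (lam X F) X Y :=
  ⟨⟨isFun_lam h, fun x x' y hx hx' => by
    rw [maps_lam] at hx hx'
    exact inj x x' hx.1 hx'.1 (hx.2.symm.trans hx'.2)⟩, fun y hy => by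
      simpa using surj y hy⟩

theorem CardEq.intro {X Y : M} (F : M → M) [DefFun₁ F] (h : ∀ x, x ∈ᴹ X → F x ∈ᴹ Y)
    (inj : ∀ x y, x ∈ᴹ X → y ∈ᴹ X → F x = F y → x = y)
    (surj : ∀ y, y ∈ᴹ Y → ∃ x, x ∈ᴹ X ∧ y = F x) : CardEq X Y :=
  ⟨lam X F, isBij_lam h inj surj⟩

theorem IsBij.elim {f X Y : M} (hf : IsBij f X Y) :
    (∀ x, x ∈ᴹ X → app f x ∈ᴹ Y) ∧
    (∀ x y, x ∈ᴹ X → y ∈ᴹ X → app f x = app f y → x = y) ∧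
      ∀ y, y ∈ᴹ Y → ∃ x, x ∈ᴹ X ∧ y = app f x := by
  obtain ⟨⟨hf, inj⟩, surj⟩ := hf
  exact ⟨fun x hx => hf.app_mem hx, fun x y hx hy e =>
    inj x y _ (hf.maps_iff.2 ⟨hx, rfl⟩) (hf.maps_iff.2 ⟨hy, e⟩), fun y hy =>
      (surj y hy).imp fun x hx => hf.maps_iff.1 hx⟩

theorem CardEq.elim {X Y : M} (h : CardEq X Y) : ∃ F : M → M, DefFun₁ F ∧
    (∀ x, x ∈ᴹ X → F x ∈ᴹ Y) ∧ (∀ x y, x ∈ᴹ X → y ∈ᴹ X → F x = F y → x = y) ∧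
      ∀ y, y ∈ᴹ Y → ∃ x, x ∈ᴹ X ∧ y = F x := by
  obtain ⟨f, hf⟩ := h
  exact ⟨app f, inferInstance, hf.elim⟩

omit [ZF M] in
theorem CardEq.le {X Y : M} (h : CardEq X Y) : CardLE X Y := h.imp fun _ h => h.1

theorem CardLE.of_incl {X Y : M} (h : Incl X Y) : CardLE X Y := .intro (fun x =>
    x) h fun _ _ _ _ e => e

theorem CardLE.trans {X Y Z : M} (h : CardLE X Y) (h' : CardLE Y Z) : CardLE X Z := by
  obtain ⟨F, _, hF, iF⟩ := h.elim
  obtain ⟨G, _, hG, iG⟩ := h'.elim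
  exact .intro (fun x => G (F x)) (fun x hx => hG _ (hF x hx)) fun x y hx hy e =>
    iF x y hx hy (iG _ _ (hF x hx) (hF y hy) e)

theorem CardEq.symm {X Y : M} (h : CardEq X Y) : CardEq Y X := by
  obtain ⟨F, _, hF, iF, sF⟩ := h.elim
  have key : ∀ y, y ∈ᴹ Y → ∃! x, x ∈ᴹ X ∧ y = F x := fun y hy => by
    obtain ⟨x, hx, e⟩ := sF y hy
    exact ⟨x, ⟨hx, e⟩, fun x' hx' => iF x' x hx'.1 hx (hx'.2.symm.trans e)⟩
  refine .intro (fun y => the fun x => x ∈ᴹ X ∧ y = F x) (fun y hy => (the_spec (key y hy)).1)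
    (fun y y' hy hy' e => ?_) fun x hx => ⟨F x, hF x hx, (the_eq (key _ (hF x hx)) ⟨hx, rfl⟩).symm⟩
  have h1 := (the_spec (key y hy)).2
  have h2 := (the_spec (key y' hy')).2
  rw [h1, e, ← h2]

theorem CardEq.trans {X Y Z : M} (h : CardEq X Y) (h' : CardEq Y Z) : CardEq X Z := by
  obtain ⟨F, _, hF, iF, sF⟩ := h.elim
  obtain ⟨G, _, hG, iG, sG⟩ := h'.elim
  refine .intro (fun x => G (F x)) (fun x hx => hG _ (hF x hx)) (fun x y hx hy e =>
    iF x y hx hy (iG _ _ (hF x hx) (hF y hy) e)) fun z hz => ?_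
  obtain ⟨y, hy, rfl⟩ := sG z hz
  obtain ⟨x, hx, rfl⟩ := sF y hy
  exact ⟨x, hx, rfl⟩

end Basic

section Ordinals

variable {M : Type u} [LSet.Structure M] [ZF M]

/-! ### Ordinals -/

theorem exists_mem_minimal {x : M} (h : ∃ y, y ∈ᴹ x) : ∃ y, y ∈ᴹ x ∧ ∀ z, z ∈ᴹ y → ¬ z ∈ᴹ x :=
  ZF.out.foundation x h

theorem mem_asymm {x y : M} (h : x ∈ᴹ y) : ¬ y ∈ᴹ x := by
  intro h'
  obtain ⟨z, hz, hmin⟩ := exists_mem_minimal ⟨x, (mem_upair (x := x) (y := y)).2 (.inl rfl)⟩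
  rcases mem_upair.1 hz with rfl | rfl
  · exact hmin _ h' (mem_upair.2 (.inr rfl))
  · exact hmin _ h (mem_upair.2 (.inl rfl))

theorem mem_irrefl (x : M) : ¬ x ∈ᴹ x := fun h => mem_asymm h h

theorem ne_of_mem {x y : M} (h : x ∈ᴹ y) : x ≠ y := fun e => mem_irrefl y (e ▸ h)

omit [ZF M] in
theorem IsOrd.trans {x y z : M} (hx : IsOrd x) (hy : y ∈ᴹ x) (hz : z ∈ᴹ y) : z ∈ᴹ x :=
  hx.1 y hy z hz

theorem IsOrd.mem {x y : M} (hx : IsOrd x) (hy : y ∈ᴹ x) : IsOrd y := by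
  refine ⟨fun z hz t ht => ?_, fun z t hz ht => hx.2 z t (hx.trans hy hz) (hx.trans hy ht)⟩
  rcases hx.2 t y (hx.trans (hx.trans hy hz) ht) hy with h | h | h
  · exact h
  · exact absurd (h ▸ ht) (mem_asymm hz)
  · exfalso
    obtain ⟨m, hm, hmin⟩ := exists_mem_minimal (x := union (upair t y) (upair z z)) ⟨t, by simp⟩
    simp only [mem_union, mem_upair, or_self] at hm hmin
    rcases hm with (rfl | rfl) | rfl
    · exact hmin _ h (.inl (.inr rfl))
    · exact hmin _ hz (.inr rfl)
    · exact hmin _ ht (.inl (.inl rfl))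

theorem IsOrd.mem_of_incl_ne {a b : M} (ha : IsOrd a) (hb : IsOrd b) (h : Incl a b)
    (hne : a ≠ b) : a ∈ᴹ b := by
  obtain ⟨c, hc, hmin⟩ := exists_mem_minimal (x := sep b fun x => ¬ x ∈ᴹ a) (by
    by_contra hcon
    push Not at hcon
    exact hne (h.antisymm fun z hz => by
      by_contra hz'
      exact hcon z (mem_sep.2 ⟨hz, hz'⟩)))
  simp only [mem_sep] at hc hmin
  have : a = c := ext fun x => ⟨fun hx => by
    rcases hb.2 x c (h x hx) hc.1 with h1 | rfl | h1
    · exact h1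
    · exact absurd hx hc.2
    · exact absurd (ha.trans hx h1) hc.2, fun hx => by
    by_contra hx'
    exact hmin x hx ⟨hb.trans hc.1 hx, hx'⟩⟩
  exact this ▸ hc.1

theorem IsOrd.trichotomy {a b : M} (ha : IsOrd a) (hb : IsOrd b) : a ∈ᴹ b ∨ a = b ∨ b ∈ᴹ a := by
  have hi : IsOrd (sep a fun x => x ∈ᴹ b) := by
    refine ⟨fun y hy z hz => ?_, fun y z hy hz => ?_⟩
    · rw [mem_sep] at hy ⊢
      exact ⟨ha.trans hy.1 hz, hb.trans hy.2 hz⟩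
    · rw [mem_sep] at hy hz
      exact ha.2 y z hy.1 hz.1
  by_cases h1 : sep a (fun x => x ∈ᴹ b) = a
  · have : Incl a b := fun x hx => by
      rw [← h1, mem_sep] at hx
      exact hx.2
    by_cases h : a = b
    · exact .inr (.inl h)
    · exact .inl (ha.mem_of_incl_ne hb this h)
  by_cases h2 : sep a (fun x => x ∈ᴹ b) = b
  · have : Incl b a := fun x hx => by
      rw [← h2, mem_sep] at hx
      exact hx.1
    by_cases h : a = b
    · exact .inr (.inl h)
    · exact .inr (.inr (hb.mem_of_incl_ne ha this (Ne.symm h)))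
  · have h3 := hi.mem_of_incl_ne ha (fun x hx => (mem_sep.1 hx).1) h1
    have h4 := hi.mem_of_incl_ne hb (fun x hx => (mem_sep.1 hx).2) h2
    exact absurd (mem_sep.2 ⟨h3, h4⟩) (mem_irrefl _)

theorem IsOrd.incl_iff {a b : M} (ha : IsOrd a) (hb : IsOrd b) : Incl a b ↔ a ∈ᴹ b ∨ a = b :=
  ⟨fun h => (em (a = b)).elim .inr fun hn => .inl (ha.mem_of_incl_ne hb h hn), fun h =>
    h.elim (fun h => hb.1 a h) fun h => h ▸ incl_refl a⟩

theorem IsOrd.not_mem_iff {a b : M} (ha : IsOrd a) (hb : IsOrd b) : ¬ a ∈ᴹ b ↔ Incl b a := by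
  rw [hb.incl_iff ha]
  constructor
  · intro h
    rcases ha.trichotomy hb with h' | h' | h'
    exacts [absurd h' h, .inr h'.symm, .inl h']
  · rintro (h | rfl)
    exacts [mem_asymm h, mem_irrefl _]

theorem IsOrd.mem_of_incl_of_mem {a b c : M} (ha : IsOrd a) (hc : IsOrd c) (h : Incl a b)
    (hb : b ∈ᴹ c) : a ∈ᴹ c := by
  rcases (ha.incl_iff (hc.mem hb)).1 h with h | rfl
  exacts [hc.trans hb h, hb]

/-- Every nonempty definable class of ordinals has a least element. -/
theorem exists_least {P : M → Prop} [DefRel₁ P] {a : M} (ha : IsOrd a) (hP : P a) :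
    ∃ b, IsOrd b ∧ P b ∧ ∀ c, c ∈ᴹ b → ¬ P c := by
  by_cases h : ∃ y, y ∈ᴹ sep a P
  · obtain ⟨b, hb, hmin⟩ := exists_mem_minimal h
    rw [mem_sep] at hb
    refine ⟨b, ha.mem hb.1, hb.2, fun c hc hPc => hmin c hc (mem_sep.2 ⟨ha.trans hb.1 hc, hPc⟩)⟩
  · exact ⟨a, ha, hP, fun c hc hPc => h ⟨c, mem_sep.2 ⟨hc, hPc⟩⟩⟩

theorem isOrd_emp : IsOrd (emp : M) := by simp [IsOrd]

theorem IsOrd.succ {a : M} (ha : IsOrd a) : IsOrd (succ a) := by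
  constructor
  · intro y hy z hz
    rw [mem_succ] at hy ⊢
    rcases hy with hy | rfl
    exacts [.inl (ha.trans hy hz), .inl hz]
  · intro y z hy hz
    have h : ∀ {t : M}, t ∈ᴹ ZFModel.succ a → IsOrd t := fun {t} ht => by
      rcases mem_succ.1 ht with ht | rfl
      exacts [ha.mem ht, ha]
    exact (h hy).trichotomy (h hz)

theorem mem_succ_self (a : M) : a ∈ᴹ succ a := mem_succ.2 (.inr rfl)

theorem succ_ne_emp (a : M) : succ a ≠ emp := fun h => not_mem_emp a (h ▸ mem_succ_self a)

theorem IsOrd.mem_succ_iff {a b : M} (ha : IsOrd a) (hb : IsOrd b) :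
    a ∈ᴹ ZFModel.succ b ↔ Incl a b := by
  rw [mem_succ, ha.incl_iff hb]

theorem succ_inj {a b : M} : succ a = succ b ↔ a = b := by
  refine ⟨fun h => ?_, fun h => h ▸ rfl⟩
  have h1 := mem_succ.1 (h ▸ mem_succ_self a)
  have h2 := mem_succ.1 (h ▸ mem_succ_self b)
  rcases h1 with h1 | h1
  · rcases h2 with h2 | h2
    exacts [absurd h2 (mem_asymm h1), h2.symm]
  · exact h1

theorem isOrd_of_transitive {x : M} (h : ∀ y z, y ∈ᴹ x → z ∈ᴹ y → z ∈ᴹ x)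
    (ho : ∀ y, y ∈ᴹ x → IsOrd y) : IsOrd x :=
  ⟨fun y hy z hz => h y z hy hz, fun y z hy hz => (ho y hy).trichotomy (ho z hz)⟩

theorem isOrd_sUnion {x : M} (ho : ∀ y, y ∈ᴹ x → IsOrd y) : IsOrd (sUnion x) := by
  refine isOrd_of_transitive (fun y z hy hz => ?_) fun y hy => ?_
  · obtain ⟨t, ht, hy⟩ := mem_sUnion.1 hy
    exact mem_sUnion.2 ⟨t, ht, (ho t ht).trans hy hz⟩
  · obtain ⟨t, ht, hy⟩ := mem_sUnion.1 hy
    exact (ho t ht).mem hy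

theorem IsOrd.sUnion_succ {a : M} (ha : IsOrd a) : sUnion (ZFModel.succ a) = a := by
  ext z
  simp only [mem_sUnion, mem_succ]
  constructor
  · rintro ⟨y, hy | rfl, hz⟩
    exacts [ha.trans hy hz, hz]
  · exact fun h => ⟨a, .inr rfl, h⟩

theorem IsOrd.eq_emp_or {a : M} (ha : IsOrd a) : a = emp ∨ emp ∈ᴹ a := by
  rcases ha.trichotomy isOrd_emp with h | h | h
  exacts [absurd h (not_mem_emp _), .inl h, .inr h]

/-! ### Natural numbers -/

theorem isNat_emp : IsNat (emp : M) := ⟨isOrd_emp, by simp⟩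

theorem IsNat.succ {n : M} (h : IsNat n) : IsNat (succ n) := by
  refine ⟨h.1.succ, fun m hm => ?_⟩
  rcases hm with rfl | hm
  · exact .inr ⟨n, by simp⟩
  · exact h.2 m ((mem_succ.1 hm).elim .inr .inl)

theorem IsNat.mem {n m : M} (h : IsNat n) (hm : m ∈ᴹ n) : IsNat m := by
  refine ⟨h.1.mem hm, fun k hk => h.2 k (.inr ?_)⟩
  rcases hk with rfl | hk
  exacts [hm, h.1.trans hm hk]

theorem IsNat.cases {n : M} (h : IsNat n) : n = emp ∨ ∃ k, IsNat k ∧ n = ZFModel.succ k := by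
  rcases h.2 n (.inl rfl) with h1 | ⟨k, hk⟩
  · exact .inl (by simpa using h1)
  · rw [isSucc_iff] at hk
    exact .inr ⟨k, h.mem (hk ▸ mem_succ_self k), hk⟩

theorem nat_induction {P : M → Prop} [DefRel₁ P] (h0 : P emp)
    (hs : ∀ n, IsNat n → P n → P (succ n)) {n : M} (hn : IsNat n) : P n := by
  by_contra hP
  obtain ⟨m, -, ⟨hm, hPm⟩, hmin⟩ := exists_least (P := fun m => IsNat m ∧ ¬ P m) hn.1 ⟨hn, hP⟩
  rcases hm.cases with rfl | ⟨k, hk, rfl⟩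
  · exact hPm h0
  · refine hPm (hs k hk ?_)
    by_contra hPk
    exact hmin k (mem_succ_self k) ⟨hk, hPk⟩

/-- The set of natural numbers. -/
noncomputable def omega : M := compr IsNat

@[simp] theorem mem_omega {n : M} : n ∈ᴹ omega ↔ IsNat n := by
  refine mem_compr ?_ n
  obtain ⟨w, ⟨e, he, he'⟩, hw⟩ := (ZF.out (M := M)).infinity
  refine ⟨sep w IsNat, fun n => ?_⟩
  rw [mem_sep, and_iff_right_iff_imp]
  refine fun hn => nat_induction (P := fun n => n ∈ᴹ w) ?_ ?_ hn
  · exact isEmptySet_iff.1 he' ▸ he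
  · intro n _ hn
    obtain ⟨y, hy, hs⟩ := hw n hn
    exact isSucc_iff.1 hs ▸ hy

theorem isOrd_omega : IsOrd (omega : M) :=
  isOrd_of_transitive (fun y z hy hz => by
    rw [mem_omega] at hy ⊢
    exact hy.mem hz) fun y hy => (mem_omega.1 hy).1

/-- A nonempty definable class of natural numbers with an upper bound has a greatest element. -/
theorem exists_greatest_nat {P : M → Prop} [DefRel₁ P] {n : M} (hn : IsNat n)
    (hb : ∀ k, P k → k ∈ᴹ n) (hne : ∃ k, P k) : ∃ k, P k ∧ ∀ l, P l → Incl l k := by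
  obtain ⟨m, hm, hPm, hmin⟩ := exists_least (P := fun n => IsNat n ∧ ∀ k, P k → k ∈ᴹ n) hn.1 ⟨hn,
      hb⟩
  rcases hPm.1.cases with rfl | ⟨k, hk, rfl⟩
  · obtain ⟨k, hk⟩ := hne
    exact absurd (hPm.2 k hk) (not_mem_emp k)
  · have := hmin k (mem_succ_self k)
    push Not at this
    obtain ⟨l, hl, hlk⟩ := this hk
    rcases mem_succ.1 (hPm.2 l hl) with h | rfl
    · exact absurd h hlk
    · exact ⟨l, hl, fun j hj => ((hm.mem (hPm.2 j hj)).mem_succ_iff hk.1).1 (hPm.2 j hj)⟩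

/-! ### Recursion along well-founded relations -/

/-- `R` restricted to the set `X` is transitive and well-founded. -/
structure IsWF (X : M) (R : M → M → Prop) : Prop where
  trans : ∀ x y z, x ∈ᴹ X → y ∈ᴹ X → z ∈ᴹ X → R x y → R y z → R x z
  wf : ∀ Y, Incl Y X → (∃ y, y ∈ᴹ Y) → ∃ y, y ∈ᴹ Y ∧ ∀ z, z ∈ᴹ Y → ¬ R z y

theorem IsWF.induction {X : M} {R : M → M → Prop} [DefRel₂ R] (h : IsWF X R) {P : M → Prop}
    [DefRel₁ P] (hP : ∀ x, x ∈ᴹ X → (∀ y, y ∈ᴹ X → R y x → P y) → P x) : ∀ x, x ∈ᴹ X → P x := by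
  intro x hx
  by_contra hPx
  obtain ⟨y, hy, hmin⟩ := h.wf (sep X fun x => ¬ P x) (fun z hz => (mem_sep.1 hz).1)
    ⟨x, mem_sep.2 ⟨hx, hPx⟩⟩
  rw [mem_sep] at hy
  refine hy.2 (hP y hy.1 fun z hz hzy => ?_)
  by_contra hPz
  exact hmin z (mem_sep.2 ⟨hz, hPz⟩) hzy

theorem lam_congr {X : M} {F G : M → M} [DefFun₁ F] [DefFun₁ G] (h : ∀ x, x ∈ᴹ X → F x = G x) :
    lam X F = lam X G := by
  unfold lam
  ext p
  simp only [mem_image]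
  refine exists_congr fun x => and_congr_right fun hx => by rw [h x hx]

/-- `f` is a function with domain `D` which obeys the recursion given by `G` along `R`. -/
def IsAttempt (X : M) (R : M → M → Prop) (G : M → M → M) (D f : M) : Prop :=
  f = lam D fun x => G x (lam (sep X fun y => R y x) (app f))

instance {X : M} {R : M → M → Prop} {G : M → M → M} [DefRel₂ R] [DefFun₂ G] :
    DefRel₂ (IsAttempt X R G) := ⟨by unfold IsAttempt; infer_instance⟩

section Recursion

variable {X : M} {R : M → M → Prop} {G : M → M → M} [DefRel₂ R] [DefFun₂ G]

theorem IsAttempt.app_eq {D f x : M} (h : IsAttempt X R G D f) (hx : x ∈ᴹ D) :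
    app f x = G x (lam (sep X fun y => R y x) (app f)) := by
  conv_lhs => rw [h]
  exact app_lam hx

theorem IsAttempt.agree (hwf : IsWF X R) {D D' f f' : M}
    (hD : ∀ x y, x ∈ᴹ D → y ∈ᴹ X → R y x → y ∈ᴹ D) (hD' : ∀ x y, x ∈ᴹ D' → y ∈ᴹ X → R y x → y ∈ᴹ D')
    (h : IsAttempt X R G D f) (h' : IsAttempt X R G D' f') :
    ∀ x, x ∈ᴹ X → x ∈ᴹ D → x ∈ᴹ D' → app f x = app f' x := by
  refine hwf.induction (P := fun x => x ∈ᴹ D → x ∈ᴹ D' → app f x = app f' x)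
    fun x hx ih hxD hxD' => ?_
  rw [h.app_eq hxD, h'.app_eq hxD']
  congr 1
  refine lam_congr fun y hy => ?_
  rw [mem_sep] at hy
  exact ih y hy.1 hy.2 (hD x y hxD hy.1 hy.2) (hD' x y hxD' hy.1 hy.2)

theorem IsAttempt.restrict {D f D' : M} (h : IsAttempt X R G D f)
    (hD' : ∀ x y, x ∈ᴹ D' → y ∈ᴹ X → R y x → y ∈ᴹ D') (hi : Incl D' D) :
    IsAttempt X R G D' (lam D' (app f)) := by
  refine lam_congr fun x hx => ?_
  rw [h.app_eq (hi x hx)]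
  congr 1
  refine lam_congr fun y hy => ?_
  rw [mem_sep] at hy
  rw [app_lam (hD' x y hx hy.1 hy.2)]

theorem IsAttempt.extend (hwf : IsWF X R) {D : M} (hDX : Incl D X)
    (hD : ∀ x y, x ∈ᴹ D → y ∈ᴹ X → R y x → y ∈ᴹ D)
    (h : ∀ x, x ∈ᴹ D → ∃ f, IsAttempt X R G (sep X fun y => R y x) f) :
    ∃ f, IsAttempt X R G D f := by
  have seg : ∀ x, x ∈ᴹ X → ∀ y z, (y ∈ᴹ sep X fun y => R y x) → z ∈ᴹ X → R z y →
      z ∈ᴹ sep X fun y => R y x := fun x hx y z hy hz hzy => by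
    rw [mem_sep] at hy ⊢
    exact ⟨hz, hwf.trans z y x hz hy.1 hx hzy hy.2⟩
  have uniq : ∀ x, x ∈ᴹ X → ∀ f f', IsAttempt X R G (sep X fun y => R y x) f →
      IsAttempt X R G (sep X fun y => R y x) f' → f = f' := fun x hx f f' hf hf' => by
    rw [hf, hf']
    refine lam_congr fun y hy => ?_
    congr 1
    refine lam_congr fun z hz => ?_
    have hz' := seg x hx y z hy (mem_sep.1 hz).1 (mem_sep.1 hz).2
    exact hf.agree hwf (seg x hx) (seg x hx) hf' z (mem_sep.1 hz).1 hz' hz'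
  have ex : ∀ x, x ∈ᴹ D → ∃! f, IsAttempt X R G (sep X fun y => R y x) f := fun x hx =>
    existsUnique_of_exists_of_unique (h x hx) (uniq x (hDX x hx))
  let H : M → M := fun x => the fun f => IsAttempt X R G (sep X fun y => R y x) f
  have hH : ∀ x, x ∈ᴹ D → IsAttempt X R G (sep X fun y => R y x) (H x) := fun x hx =>
    the_spec (ex x hx)
  have dH : DefFun₁ H := by
    have : DefFun₁ fun x => the fun f => IsAttempt X R G (sep X fun y => R y x) f := inferInstance
    exact this
  refine ⟨lam D fun x => G x (H x), lam_congr fun x hx => ?_⟩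
  congr 1
  refine (hH x hx).trans (lam_congr fun z hz => ?_)
  have hz0 := mem_sep.1 hz
  have hzD := hD x z hx hz0.1 hz0.2
  rw [app_lam hzD]
  congr 1
  exact uniq z hz0.1 _ _ ((hH x hx).restrict (seg z hz0.1) fun y hy => seg x (hDX x hx) z y hz
    (mem_sep.1 hy).1 (mem_sep.1 hy).2) (hH z hzD)

/-- Recursion along a definable transitive well-founded relation on a set. -/
theorem IsWF.recursion (hwf : IsWF X R) (G : M → M → M) [DefFun₂ G] :
    ∃ F : M → M, DefFun₁ F ∧ ∀ x, x ∈ᴹ X → F x = G x (lam (sep X fun y => R y x) F) := by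
  have h1 : ∀ x, x ∈ᴹ X → ∃ f, IsAttempt X R G (sep X fun y => R y x) f := by
    refine hwf.induction fun x hx ih => ?_
    refine IsAttempt.extend hwf (fun y hy => (mem_sep.1 hy).1) (fun y z hy hz hzy => ?_) fun y hy =>
      ih y (mem_sep.1 hy).1 (mem_sep.1 hy).2
    rw [mem_sep] at hy ⊢
    exact ⟨hz, hwf.trans z y x hz hy.1 hx hzy hy.2⟩
  obtain ⟨f, hf⟩ := IsAttempt.extend hwf (incl_refl X) (fun _ _ _ h _ => h) h1
  exact ⟨app f, inferInstance, fun x hx => hf.app_eq hx⟩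

end Recursion

theorem IsOrd.isWF {a : M} (ha : IsOrd a) : IsWF a fun x y => x ∈ᴹ y :=
  ⟨fun _ _ _ _ _ hz h h' => (ha.mem hz).trans h' h, fun _ _ hne =>
    (exists_mem_minimal hne).imp fun _ hy => ⟨hy.1, fun z hz hzy => hy.2 z hzy hz⟩⟩

end Ordinals

section Cardinals

variable {M : Type u} [LSet.Structure M] [ZF M]

/-! ### Order types -/

/-- The least ordinal `a` with `P a`. -/
noncomputable def least (P : M → Prop) : M := the fun a => IsOrd a ∧ P a ∧ ∀ b, b ∈ᴹ a → ¬ P b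

instance (priority := 1100) DefF.least {P : M → (ℕ → M) → Prop}
    [h : Def fun v => P (v 0) fun i => v (i + 1)] : DefF fun v => least fun x => P x v := by
  unfold ZFModel.least
  have : Def fun v : ℕ → M => P (v 0) fun i => v (i + 1 + 1) :=
    h.reindex fun i => if i = 0 then 0 else i + 1
  apply DefF.the (M := M) (P := fun a v => IsOrd a ∧ P a v ∧ ∀ b, b ∈ᴹ a → ¬ P b v)

theorem least_spec {P : M → Prop} [DefRel₁ P] {a : M} (ha : IsOrd a) (hP : P a) :
    IsOrd (least P) ∧ P (least P) ∧ ∀ b, b ∈ᴹ least P → ¬ P b := by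
  obtain ⟨b, hb, hPb, hmin⟩ := exists_least ha hP
  refine the_spec (P := fun a => IsOrd a ∧ P a ∧ ∀ b, b ∈ᴹ a → ¬ P b) ⟨b, ⟨hb, hPb, hmin⟩, ?_⟩
  rintro c ⟨hc, hPc, hminc⟩
  rcases hc.trichotomy hb with h | h | h
  exacts [absurd hPc (hmin c h), h, absurd hPb (hminc b h)]

theorem least_incl {P : M → Prop} [DefRel₁ P] {a : M} (ha : IsOrd a) (hP : P a) :
    Incl (least P) a := by
  obtain ⟨h1, -, h3⟩ := least_spec ha hP
  exact (ha.not_mem_iff h1).1 fun h => h3 a h hP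

/-- A strictly increasing map from an ordinal onto an ordinal is the identity. -/
theorem IsOrd.eq_of_iso {a b : M} (ha : IsOrd a) (hb : IsOrd b) {F : M → M} [DefFun₁ F]
    (hF : ∀ i, i ∈ᴹ a → F i ∈ᴹ b) (mono : ∀ i j, i ∈ᴹ a → j ∈ᴹ a → i ∈ᴹ j → F i ∈ᴹ F j)
    (surj : ∀ j, j ∈ᴹ b → ∃ i, i ∈ᴹ a ∧ j = F i) : a = b := by
  have key : ∀ i, i ∈ᴹ a → F i = i := by
    refine ha.isWF.induction (P := fun i => F i = i) fun i hi ih => ext fun z => ⟨fun hz => ?_,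
        fun hz => ?_⟩
    · obtain ⟨k, hk, rfl⟩ := surj z (hb.trans (hF i hi) hz)
      rcases ha.2 k i hk hi with h | rfl | h
      · rwa [ih k hk h]
      · exact absurd hz (mem_irrefl _)
      · exact absurd hz (mem_asymm (mono i k hi hk h))
    · have hza := ha.trans hi hz
      rw [← ih z hza hz]
      exact mono z i hza hi hz
  ext z
  constructor
  · intro hz
    rw [← key z hz]
    exact hF z hz
  · intro hz
    obtain ⟨k, hk, rfl⟩ := surj z hz
    rwa [key k hk]

/-- Mostowski collapse of a well-ordered set. -/
theorem exists_collapse {X : M} {R : M → M → Prop} [DefRel₂ R] (hwf : IsWF X R)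
    (lin : ∀ x y, x ∈ᴹ X → y ∈ᴹ X → R x y ∨ x = y ∨ R y x) :
    ∃ (a : M) (F : M → M), IsOrd a ∧ DefFun₁ F ∧ (∀ x, x ∈ᴹ X → F x ∈ᴹ a) ∧
      (∀ i, i ∈ᴹ a → ∃ x, x ∈ᴹ X ∧ i = F x) ∧
      (∀ x y, x ∈ᴹ X → y ∈ᴹ X → (F x ∈ᴹ F y ↔ R x y)) ∧
      (∀ x y, x ∈ᴹ X → y ∈ᴹ X → F x = F y → x = y) ∧
      ∀ x, x ∈ᴹ X → F x = image (sep X fun y => R y x) F := by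
  obtain ⟨F, hFd, hF⟩ := hwf.recursion fun x h => image (sep X fun y => R y x) (app h)
  have hF' : ∀ x, x ∈ᴹ X → F x = image (sep X fun y => R y x) F := fun x hx => by
    rw [hF x hx]
    ext z
    simp only [mem_image]
    refine exists_congr fun y => and_congr_right fun hy => ?_
    rw [app_lam hy]
  have hmem : ∀ x, x ∈ᴹ X → ∀ z, z ∈ᴹ F x ↔ ∃ y, (y ∈ᴹ X ∧ R y x) ∧ z = F y := fun x hx z => by
    rw [hF' x hx, mem_image]
    simp only [mem_sep]
  have mono : ∀ x y, x ∈ᴹ X → y ∈ᴹ X → R x y → F x ∈ᴹ F y := fun x y hx hy h =>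
    (hmem y hy _).2 ⟨x, ⟨hx, h⟩, rfl⟩
  have inj : ∀ x y, x ∈ᴹ X → y ∈ᴹ X → F x = F y → x = y := fun x y hx hy h => by
    rcases lin x y hx hy with h' | h' | h'
    · exact absurd (h ▸ mono x y hx hy h') (mem_irrefl _)
    · exact h'
    · exact absurd (h ▸ mono y x hy hx h') (mem_irrefl _)
  have ho : ∀ x, x ∈ᴹ X → IsOrd (F x) := by
    refine hwf.induction fun x hx ih => isOrd_of_transitive (fun y z hy hz => ?_) fun y hy => ?_
    · obtain ⟨w, hw, rfl⟩ := (hmem x hx y).1 hy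
      obtain ⟨t, ht, rfl⟩ := (hmem w hw.1 z).1 hz
      exact mono t x ht.1 hx (hwf.trans t w x ht.1 hw.1 hx ht.2 hw.2)
    · obtain ⟨w, hw, rfl⟩ := (hmem x hx y).1 hy
      exact ih w hw.1 hw.2
  refine ⟨image X F, F, isOrd_of_transitive (fun y z hy hz => ?_) fun y hy => ?_, hFd,
    fun x hx => mem_image.2 ⟨x, hx, rfl⟩, fun i hi => mem_image.1 hi, fun x y hx hy => ⟨fun h => ?_,
      mono x y hx hy⟩, inj, hF'⟩
  · obtain ⟨w, hw, rfl⟩ := mem_image.1 hy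
    obtain ⟨t, ht, rfl⟩ := (hmem w hw z).1 hz
    exact mem_image.2 ⟨t, ht.1, rfl⟩
  · obtain ⟨w, hw, rfl⟩ := mem_image.1 hy
    exact ho w hw
  · obtain ⟨w, hw, e⟩ := (hmem y hy _).1 h
    rw [inj x w hx hw.1 e]
    exact hw.2

omit [ZF M] in
theorem HasOrderType.cardEq {S a : M} (h : HasOrderType S a) : CardEq a S := h.imp fun _ h => h.1

theorem HasOrderType.elim {S a : M} (h : HasOrderType S a) : ∃ G : M → M, DefFun₁ G ∧
    (∀ i, i ∈ᴹ a → G i ∈ᴹ S) ∧ (∀ i j, i ∈ᴹ a → j ∈ᴹ a → i ∈ᴹ j → G i ∈ᴹ G j) ∧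
      ∀ x, x ∈ᴹ S → ∃ i, i ∈ᴹ a ∧ x = G i := by
  obtain ⟨g, hg, mono⟩ := h
  exact ⟨app g, inferInstance, hg.elim.1, fun i j hi hj hij => mono i j _ _
    (hg.1.1.maps_iff.2 ⟨hi, rfl⟩) (hg.1.1.maps_iff.2 ⟨hj, rfl⟩) hij, hg.elim.2.2⟩

theorem HasOrderType.intro {S a : M} (ha : IsOrd a) (G : M → M) [DefFun₁ G]
    (hG : ∀ i, i ∈ᴹ a → G i ∈ᴹ S) (mono : ∀ i j, i ∈ᴹ a → j ∈ᴹ a → i ∈ᴹ j → G i ∈ᴹ G j)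
    (surj : ∀ x, x ∈ᴹ S → ∃ i, i ∈ᴹ a ∧ x = G i) : HasOrderType S a := by
  refine ⟨lam a G, isBij_lam hG (fun i j hi hj e => ?_) surj, fun i j x y hx hy hij => ?_⟩
  · rcases ha.2 i j hi hj with h | h | h
    · exact absurd (e ▸ mono i j hi hj h) (mem_irrefl _)
    · exact h
    · exact absurd (e ▸ mono j i hj hi h) (mem_irrefl _)
  · rw [maps_lam] at hx hy
    obtain ⟨hi, rfl⟩ := hx
    obtain ⟨hj, rfl⟩ := hy
    exact mono i j hi hj hij

/-- A subset of an ordinal `d` has an order type, which is at most `d`. -/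
theorem exists_orderType {S d : M} (hd : IsOrd d) (hS : Incl S d) :
    ∃ a, IsOrd a ∧ Incl a d ∧ HasOrderType S a := by
  have hwf : IsWF S fun x y => x ∈ᴹ y := ⟨fun x y z hx hy hz =>
      hd.isWF.trans x y z (hS x hx) (hS y hy)
    (hS z hz), fun Y hY => hd.isWF.wf Y (hY.trans hS)⟩
  obtain ⟨a, F, ha, _, hF, surj, iff, inj, hF'⟩ := exists_collapse hwf
    fun x y hx hy => hd.2 x y (hS x hx) (hS y hy)
  have hle : ∀ x, x ∈ᴹ S → Incl (F x) x := by
    refine hwf.induction fun x hx ih z hz => ?_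
    rw [hF' x hx, mem_image] at hz
    obtain ⟨y, hy, rfl⟩ := hz
    rw [mem_sep] at hy
    exact (ha.mem (hF y hy.1)).mem_of_incl_of_mem (hd.mem (hS x hx)) (ih y hy.1 hy.2) hy.2
  have key : ∀ i, i ∈ᴹ a → ∃! x, x ∈ᴹ S ∧ i = F x := fun i hi => by
    obtain ⟨x, hx, e⟩ := surj i hi
    exact ⟨x, ⟨hx, e⟩, fun y hy => inj y x hy.1 hx (hy.2.symm.trans e)⟩
  refine ⟨a, ha, fun i hi => ?_, .intro ha (fun i => the fun x => x ∈ᴹ S ∧ i = F x)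
    (fun i hi => (the_spec (key i hi)).1) (fun i j hi hj hij => ?_) fun x hx =>
      ⟨F x, hF x hx, (the_eq (key _ (hF x hx)) ⟨hx, rfl⟩).symm⟩⟩
  · obtain ⟨x, hx, rfl⟩ := surj i hi
    exact (ha.mem hi).mem_of_incl_of_mem hd (hle x hx) (hS x hx)
  · have h1 := the_spec (key i hi)
    have h2 := the_spec (key j hj)
    refine (iff _ _ h1.1 h2.1).1 ?_
    rwa [← h1.2, ← h2.2]

/-! ### The successor cardinal -/

/-- The graph of the order induced on a subset of `X` by an injection `f` of the ordinal `a`. -/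
noncomputable def inducedOrder (X a f : M) : M :=
  sep (prod X X) fun p => ∃ i j, i ∈ᴹ a ∧ j ∈ᴹ a ∧ Incl i j ∧ p = pair (app f i) (app f j)

instance {X : M} : DefFun₂ (inducedOrder X) := ⟨by unfold inducedOrder; infer_instance⟩

theorem mem_inducedOrder {X a f x y : M} (hf : IsInj f a X) : pair x y ∈ᴹ inducedOrder X a f ↔
    ∃ i j, i ∈ᴹ a ∧ j ∈ᴹ a ∧ Incl i j ∧ x = app f i ∧ y = app f j := by
  simp only [inducedOrder, mem_sep, mem_prod, pair_inj]
  constructor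
  · exact fun h => h.2
  · rintro ⟨i, j, hi, hj, hij, rfl, rfl⟩
    exact ⟨⟨_, _, hf.1.app_mem hi, hf.1.app_mem hj, rfl, rfl⟩, i, j, hi, hj, hij, rfl, rfl⟩

theorem IsInj.app_inj {f X Y x y : M} (hf : IsInj f X Y) (hx : x ∈ᴹ X) (hy : y ∈ᴹ X)
    (e : app f x = app f y) : x = y :=
  hf.2 x y _ (hf.1.maps_iff.2 ⟨hx, rfl⟩) (hf.1.maps_iff.2 ⟨hy, e⟩)

/-- The induced order determines the ordinal. This makes the assignment of ordinals to the induced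
orders on subsets of `X` functional, so that replacement applies to it. -/
theorem inducedOrder_inj {X a b f g : M} (ha : IsOrd a) (hb : IsOrd b) (hf : IsInj f a X)
    (hg : IsInj g b X) (h : inducedOrder X a f = inducedOrder X b g) : a = b := by
  have h1 : ∀ i j, i ∈ᴹ a → j ∈ᴹ a → Incl i j → ∃ i' j', i' ∈ᴹ b ∧ j' ∈ᴹ b ∧ Incl i' j' ∧
      app f i = app g i' ∧ app f j = app g j' := fun i j hi hj hij => by
    rw [← mem_inducedOrder hg, ← h, mem_inducedOrder hf]
    exact ⟨i, j, hi, hj, hij, rfl, rfl⟩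
  have h2 : ∀ i, i ∈ᴹ b → ∃ i', i' ∈ᴹ a ∧ app g i = app f i' := fun i hi => by
    have := (mem_inducedOrder hg).2 ⟨i, i, hi, hi, incl_refl i, rfl, rfl⟩
    rw [← h, mem_inducedOrder hf] at this
    obtain ⟨i', -, hi', -, -, e, -⟩ := this
    exact ⟨i', hi', e⟩
  have key : ∀ i, i ∈ᴹ a → ∃! j, j ∈ᴹ b ∧ app f i = app g j := fun i hi => by
    obtain ⟨j, -, hj, -, -, e, -⟩ := h1 i i hi hi (incl_refl i)
    exact ⟨j, ⟨hj, e⟩, fun k hk => hg.app_inj hk.1 hj (hk.2.symm.trans e)⟩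
  refine ha.eq_of_iso hb (F := fun i => the fun j => j ∈ᴹ b ∧ app f i = app g j)
    (fun i hi => (the_spec (key i hi)).1) (fun i j hi hj hij => ?_) fun j hj => ?_
  · obtain ⟨i', j', hi', hj', hij', ei, ej⟩ := h1 i j hi hj (ha.mem hj |>.1 i hij)
    rw [the_eq (key i hi) ⟨hi', ei⟩, the_eq (key j hj) ⟨hj', ej⟩]
    rcases ((hb.mem hi').incl_iff (hb.mem hj')).1 hij' with h | rfl
    · exact h
    · exact absurd (hf.app_inj hi hj (ei.trans ej.symm)) (ne_of_mem hij)
  · obtain ⟨i, hi, e⟩ := h2 j hj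
    exact ⟨i, hi, (the_eq (key i hi) ⟨hj, e.symm⟩).symm⟩

/-- The Hartogs number of `X`: the set of all ordinals which inject into `X`. -/
noncomputable def hartogs (X : M) : M := compr fun a => IsOrd a ∧ CardLE a X

theorem mem_hartogs {X a : M} : a ∈ᴹ hartogs X ↔ IsOrd a ∧ CardLE a X := by
  refine mem_compr (P := fun a => IsOrd a ∧ CardLE a X) ?_ a
  refine ⟨sep (image (power (prod X X)) fun r => the fun a => IsOrd a ∧
    ∃ f, IsInj f a X ∧ r = inducedOrder X a f) fun a => IsOrd a ∧ CardLE a X, fun a => ?_⟩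
  rw [mem_sep, and_iff_right_iff_imp]
  rintro ⟨ha, f, hf⟩
  refine mem_image.2 ⟨inducedOrder X a f, mem_power.2 fun p hp => (mem_sep.1 hp).1, ?_⟩
  symm
  exact the_eq (P := fun b => IsOrd b ∧ ∃ g, IsInj g b X ∧ inducedOrder X a f = inducedOrder X b g)
    ⟨a, ⟨ha, f, hf, rfl⟩, fun b ⟨hb, g, hg, e⟩ => inducedOrder_inj hb ha hg hf e.symm⟩
    ⟨ha, f, hf, rfl⟩

theorem isOrd_hartogs (X : M) : IsOrd (hartogs X) :=
  isOrd_of_transitive (fun y z hy hz => by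
    rw [mem_hartogs] at hy ⊢
    exact ⟨hy.1.mem hz, (CardLE.of_incl (hy.1.1 z hz)).trans hy.2⟩) fun y hy => (mem_hartogs.1 hy).1

theorem cardEq_refl (X : M) : CardEq X X :=
  .intro (fun x => x) (fun _ h => h) (fun _ _ _ _ e => e) fun x hx => ⟨x, hx, rfl⟩

theorem not_hartogs_le (X : M) : ¬ CardLE (hartogs X) X := fun h =>
  mem_irrefl _ (mem_hartogs.2 ⟨isOrd_hartogs X, h⟩)

/-- A set which injects into an ordinal `d` is equinumerous to an ordinal `a ≤ d`. -/
theorem CardLE.exists_cardEq {X d : M} (hd : IsOrd d) (h : CardLE X d) :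
    ∃ a, IsOrd a ∧ Incl a d ∧ CardEq X a := by
  obtain ⟨F, _, hF, inj⟩ := h.elim
  obtain ⟨a, ha, had, hS⟩ := exists_orderType (S := image X F) hd fun y hy => by
    obtain ⟨x, hx, rfl⟩ := mem_image.1 hy
    exact hF x hx
  refine ⟨a, ha, had, CardEq.trans ?_ hS.cardEq.symm⟩
  exact .intro F (fun x hx => mem_image.2 ⟨x, hx, rfl⟩) inj fun y hy => mem_image.1 hy

/-- The Hartogs number of an ordinal `c` is `c⁺`. -/
theorem isSuccCard_hartogs {c : M} (hc : IsOrd c) : IsSuccCard c (hartogs c) := by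
  refine ⟨⟨isOrd_hartogs c, fun a ha h => ?_⟩, mem_hartogs.2 ⟨hc, (cardEq_refl c).le⟩,
      fun d hd hcd => ?_⟩
  · exact not_hartogs_le c (h.symm.le.trans (mem_hartogs.1 ha).2)
  · rcases (isOrd_hartogs c).trichotomy hd.1 with h | h | h
    · exact .inr h
    · exact .inl h
    · exfalso
      obtain ⟨a, ha, hac, h⟩ := (mem_hartogs.1 h).2.exists_cardEq hc
      exact hd.2 a (ha.mem_of_incl_of_mem hd.1 hac hcd) h.symm

theorem IsInfCard.omega_incl {c : M} (hc : IsInfCard c) : Incl omega c :=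
  (hc.1.1.not_mem_iff isOrd_omega).1 fun h => hc.2 ⟨c, mem_omega.1 h, cardEq_refl c⟩

open Classical in
/-- The successor cardinal of an infinite ordinal is a limit: for infinite `a`, the new element of
`a + 1` is sent to `0`, and the natural numbers are shifted by one to make room for it. -/
theorem succ_mem_hartogs {c a : M} (hc : Incl omega c) (ha : a ∈ᴹ hartogs c) :
    succ a ∈ᴹ hartogs c := by
  rw [mem_hartogs] at ha ⊢
  refine ⟨ha.1.succ, ?_⟩
  by_cases h : a ∈ᴹ omega
  · exact (CardLE.of_incl (isOrd_omega.1 _ (mem_omega.2 (mem_omega.1 h).succ))).trans (.of_incl hc)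
  · have h' := (ha.1.not_mem_iff isOrd_omega).1 h
    refine CardLE.trans ?_ ha.2
    have hne : ∀ x : M, IsNat x → x ≠ a := fun x hx e => h (mem_omega.2 (e ▸ hx))
    refine .intro (fun x => if x = a then emp else if IsNat x then succ x else x) (fun x hx => ?_)
      fun x y hx hy e => ?_
    · split_ifs with h1 h2
      · exact h' _ (mem_omega.2 isNat_emp)
      · exact h' _ (mem_omega.2 h2.succ)
      · exact (mem_succ.1 hx).resolve_right h1
    · have he := succ_ne_emp (M := M)
      have h0 := isNat_emp (M := M)
      have hs := fun x : M => IsNat.succ (n := x)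
      split_ifs at e <;> grind [succ_inj]

/-! ### Cofinality and unbounded classes of ordinals -/

/-- The class `S` is unbounded in the ordinal `m`. -/
def Unb (m : M) (S : M → Prop) : Prop := ∀ x, x ∈ᴹ m → ∃ y, y ∈ᴹ m ∧ S y ∧ ¬ y ∈ᴹ x

omit [ZF M] in
theorem not_unb_iff {m : M} {S : M → Prop} :
    ¬ Unb m S ↔ ∃ x, x ∈ᴹ m ∧ ∀ y, y ∈ᴹ m → S y → y ∈ᴹ x := by
  unfold Unb
  push Not
  rfl

omit [ZF M] in
theorem Unb.mono {m : M} {S T : M → Prop} (h : Unb m S) (hST : ∀ x, x ∈ᴹ m → S x → T x) : Unb m T :=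
  fun x hx => (h x hx).imp fun y hy => ⟨hy.1, hST y hy.1 hy.2.1, hy.2.2⟩

/-- No smaller ordinal has a cofinal map to `m`; for an ordinal `m` this says `cf(m) = m`. -/
def Reg (m : M) : Prop := ∀ d, d ∈ᴹ m → ¬ HasCofinalMap m d

theorem isCof_self_iff {m : M} (hm : IsOrd m) : IsCof m m ↔ Reg m := by
  refine ⟨fun h => h.2.2, fun h => ⟨hm, ⟨lam m fun x => x, isFun_lam fun _ h => h, fun x hx =>
    ⟨x, x, by simp [hx], .inl rfl⟩⟩, h⟩⟩

theorem Unb.or {m : M} (hm : IsOrd m) {S T : M → Prop} (h : Unb m fun x => S x ∨ T x) :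
    Unb m S ∨ Unb m T := by
  by_contra hcon
  rw [not_or, not_unb_iff, not_unb_iff] at hcon
  obtain ⟨⟨x, hx, hxS⟩, y, hy, hyT⟩ := hcon
  obtain ⟨z, hz, hzz, hzx⟩ : ∃ z, z ∈ᴹ m ∧ Incl x z ∧ Incl y z := by
    rcases hm.2 x y hx hy with h | rfl | h
    exacts [⟨y, hy, (hm.mem hy).1 x h, incl_refl y⟩, ⟨x, hx, incl_refl x, incl_refl x⟩,
      ⟨x, hx, incl_refl x, (hm.mem hx).1 y h⟩]
  obtain ⟨w, hw, hST, hwz⟩ := h z hz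
  exact hwz (hST.elim (fun h => hzz w (hxS w hw h)) fun h => hzx w (hyT w hw h))

theorem Unb.hasOrderType {m S : M} (hm : IsOrd m) (hr : Reg m) (hS : Incl S m)
    (h : Unb m fun x => x ∈ᴹ S) : HasOrderType S m := by
  obtain ⟨a, ha, ham, hSa⟩ := exists_orderType hm hS
  rcases (ha.incl_iff hm).1 ham with h1 | rfl
  · exfalso
    obtain ⟨G, _, hG, mono, surj⟩ := hSa.elim
    refine hr a h1 ⟨lam a G, isFun_lam fun i hi => hS _ (hG i hi), fun x hx => ?_⟩
    obtain ⟨y, hy, hyS, hyx⟩ := h x hx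
    obtain ⟨i, hi, rfl⟩ := surj y hyS
    refine ⟨i, _, maps_lam.2 ⟨hi, rfl⟩, ?_⟩
    rw [or_comm]
    exact ((hm.mem hx).incl_iff (hm.mem hy)).1 (((hm.mem hy).not_mem_iff (hm.mem hx)).1 hyx)
  · exact hSa

open Classical in
theorem HasCofinalMap.of_cardLE {m a b : M} (hm : emp ∈ᴹ m) (h : HasCofinalMap m a)
    (hab : CardLE a b) : HasCofinalMap m b := by
  obtain ⟨f, hf, hc⟩ := h
  obtain ⟨E, _, hE, inj⟩ := hab.elim
  have key : ∀ x, x ∈ᴹ a → (the fun y => y ∈ᴹ a ∧ E y = E x) = x := fun x hx =>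
    the_eq ⟨x, ⟨hx, rfl⟩, fun y hy => inj y x hy.1 hx hy.2⟩ ⟨hx, rfl⟩
  refine ⟨lam b fun i => if ∃ y, y ∈ᴹ a ∧ E y = i then app f (the fun y => y ∈ᴹ a ∧
      E y = i) else emp,
    isFun_lam fun i _ => ?_, fun x hx => ?_⟩
  · split_ifs with h
    · obtain ⟨y, hy, rfl⟩ := h
      rw [key y hy]
      exact hf.app_mem hy
    · exact hm
  · obtain ⟨i, y, hy, hxy⟩ := hc x hx
    rw [hf.maps_iff] at hy
    obtain ⟨hi, rfl⟩ := hy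
    refine ⟨E i, app f i, maps_lam.2 ⟨hE i hi, ?_⟩, hxy⟩
    rw [if_pos ⟨i, hi, rfl⟩, key i hi]

/-- A cofinal map `f` from `d` to `m` yields a weakly increasing map from `m` to `d` with bounded
fibres: it takes `a` to the least index `i` with `a ≤ f(i)`. -/
theorem HasCofinalMap.exists_index {m d : M} (hm : IsOrd m) (hd : IsOrd d)
    (hlim : ∀ x, x ∈ᴹ m → succ x ∈ᴹ m) (h : HasCofinalMap m d) : ∃ I : M → M, DefFun₁ I ∧
      (∀ a, a ∈ᴹ m → I a ∈ᴹ d) ∧ (∀ a b, a ∈ᴹ m → b ∈ᴹ m → a ∈ᴹ b → Incl (I a) (I b)) ∧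
      ∀ i, i ∈ᴹ d → ∃ x, x ∈ᴹ m ∧ ∀ a, a ∈ᴹ m → I a = i → a ∈ᴹ x := by
  obtain ⟨f, hf, hc⟩ := h
  have key : ∀ a, a ∈ᴹ m → ∃ i, IsOrd i ∧ i ∈ᴹ d ∧ Incl a (app f i) := fun a ha => by
    obtain ⟨i, y, hi, hy⟩ := hc a ha
    rw [hf.maps_iff] at hi
    obtain ⟨hi, rfl⟩ := hi
    exact ⟨i, hd.mem hi, hi, ((hm.mem ha).incl_iff (hm.mem (hf.app_mem hi))).2 hy.symm⟩
  have hI : ∀ a, a ∈ᴹ m → (least fun i => i ∈ᴹ d ∧ Incl a (app f i)) ∈ᴹ d ∧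
      Incl a (app f (least fun i => i ∈ᴹ d ∧ Incl a (app f i))) := fun a ha => by
    obtain ⟨i, hi, hid⟩ := key a ha
    exact (least_spec (P := fun i => i ∈ᴹ d ∧ Incl a (app f i)) hi hid).2.1
  refine ⟨fun a => least fun i => i ∈ᴹ d ∧ Incl a (app f i), inferInstance, fun a ha => (hI a ha).1,
    fun a b ha hb hab => ?_, fun i hi => ⟨succ (app f i), hlim _ (hf.app_mem hi), fun a ha e => ?_⟩⟩
  · exact least_incl (P := fun i => i ∈ᴹ d ∧ Incl a (app f i)) (hd.mem (hI b hb).1)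
      ⟨(hI b hb).1, ((hm.mem hb).1 a hab).trans (hI b hb).2⟩
  · have := (hI a ha).2
    beta_reduce at e
    rw [e] at this
    exact ((hm.mem ha).mem_succ_iff (hm.mem (hf.app_mem hi))).2 this

/-- A union, indexed by a set of size at most `c`, of bounded subsets of the regular `c⁺` is
bounded. -/
theorem Reg.bounded_union {c : M} (hc : IsOrd c) (hr : Reg (hartogs c)) {Y : M} (hY : CardLE Y c)
    {R : M → M → Prop} [DefRel₂ R] (hb : ∀ y, y ∈ᴹ Y → ¬ Unb (hartogs c) (R y)) :
    ∃ x, x ∈ᴹ hartogs c ∧ ∀ y, y ∈ᴹ Y → ∀ a, a ∈ᴹ hartogs c → R y a → a ∈ᴹ x := by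
  have hm := isOrd_hartogs c
  have hcm : c ∈ᴹ hartogs c := mem_hartogs.2 ⟨hc, (cardEq_refl c).le⟩
  generalize hartogs c = m at *
  obtain ⟨E, _, hE, inj⟩ := hY.elim
  have key : ∀ i, ∃ x, IsOrd x ∧ x ∈ᴹ m ∧ ∀ y, y ∈ᴹ Y → E y = i → ∀ a, a ∈ᴹ m → R y a → a ∈ᴹ x := by
    intro i
    by_cases h : ∃ y, y ∈ᴹ Y ∧ E y = i
    · obtain ⟨y, hy, rfl⟩ := h
      obtain ⟨x, hx, hxR⟩ := not_unb_iff.1 (hb y hy)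
      refine ⟨x, hm.mem hx, hx, fun z hz e => ?_⟩
      rw [inj z y hz hy e]
      exact hxR
    · exact ⟨c, hc, hcm, fun y hy e => absurd ⟨y, hy, e⟩ h⟩
  let B : M → M := fun i => least fun x => x ∈ᴹ m ∧ ∀ y, y ∈ᴹ Y → E y = i →
    ∀ a, a ∈ᴹ m → R y a → a ∈ᴹ x
  have hB : ∀ i, B i ∈ᴹ m ∧ ∀ y, y ∈ᴹ Y → E y = i → ∀ a, a ∈ᴹ m → R y a → a ∈ᴹ B i := fun i => by
    obtain ⟨x, hx, hx'⟩ := key i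
    exact (least_spec (P := fun x => x ∈ᴹ m ∧ ∀ y, y ∈ᴹ Y → E y = i →
      ∀ a, a ∈ᴹ m → R y a → a ∈ᴹ x) hx hx').2.1
  have dB : DefFun₁ B := by
    have : DefFun₁ fun i => least fun x => x ∈ᴹ m ∧ ∀ y, y ∈ᴹ Y → E y = i →
      ∀ a, a ∈ᴹ m → R y a → a ∈ᴹ x := inferInstance
    exact this
  by_contra hcon
  push Not at hcon
  refine hr c hcm ⟨lam c B, isFun_lam fun i _ => (hB i).1, fun x hx => ?_⟩
  obtain ⟨y, hy, a, ha, hR, hax⟩ := hcon x hx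
  have h1 := (hB (E y)).2 y hy rfl a ha hR
  refine ⟨E y, B (E y), maps_lam.2 ⟨hE y hy, rfl⟩, .inr ?_⟩
  have hx' := hm.mem hx
  exact hx'.mem_of_incl_of_mem (hm.mem (hB _).1) (((hm.mem ha).not_mem_iff hx').1 hax) h1

/-- The pigeonhole principle for a partition of an unbounded subset of the regular `c⁺` into at most
`c` classes. -/
theorem Unb.pigeonhole {c : M} (hc : IsOrd c) (hr : Reg (hartogs c)) {S : M → Prop}
    (hS : Unb (hartogs c) S) {Y : M} (hY : CardLE Y c) {R : M → M → Prop} [DefRel₂ R] [DefRel₁ S]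
    (h : ∀ a, a ∈ᴹ hartogs c → S a → ∃ y, y ∈ᴹ Y ∧ R y a) :
    ∃ y, y ∈ᴹ Y ∧ Unb (hartogs c) fun a => S a ∧ R y a := by
  by_contra hcon
  push Not at hcon
  obtain ⟨x, hx, hxR⟩ := hr.bounded_union hc hY (R := fun y a => S a ∧ R y a) hcon
  obtain ⟨a, ha, hSa, hax⟩ := hS x hx
  obtain ⟨y, hy, hR⟩ := h a ha hSa
  exact hax (hxR y hy a ha ⟨hSa, hR⟩)

end Cardinals

section Regressive

variable {M : Type u} [LSet.Structure M] [ZF M] {c : M}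

/-! ### Regressive functions -/

theorem mem_hartogs_self (hc : IsOrd c) : c ∈ᴹ hartogs c := mem_hartogs.2 ⟨hc, (cardEq_refl c).le⟩

theorem emp_mem_hartogs : (emp : M) ∈ᴹ hartogs c :=
  mem_hartogs.2 ⟨isOrd_emp, .of_incl fun z hz => absurd hz (not_mem_emp z)⟩

theorem cardLE_of_mem_hartogs {x : M} (h : x ∈ᴹ hartogs c) : CardLE x c := (mem_hartogs.1 h).2

theorem omega_le (hω : Incl omega c) : CardLE omega c := .of_incl hω

/-- A subset of `c⁺` of size `c⁺` is unbounded, whether or not `c⁺` is regular. -/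
theorem unb_of_cardLE {K : M} (hK : Incl K (hartogs c)) (h : CardLE (hartogs c) K) :
    Unb (hartogs c) fun x => x ∈ᴹ K := by
  by_contra hcon
  obtain ⟨x, hx, hxK⟩ := not_unb_iff.1 hcon
  exact not_hartogs_le c (h.trans ((CardLE.of_incl fun y hy => hxK y (hK y hy) hy).trans
    (cardLE_of_mem_hartogs hx)))

theorem IsOrd.incl_of_increasing {a : M} (ha : IsOrd a) {F : M → M} [DefFun₁ F]
    (hF : ∀ i, i ∈ᴹ a → IsOrd (F i)) (mono : ∀ i j, i ∈ᴹ a → j ∈ᴹ a → i ∈ᴹ j → F i ∈ᴹ F j) :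
    ∀ i, i ∈ᴹ a → Incl i (F i) := by
  refine ha.isWF.induction (P := fun i => Incl i (F i)) fun i hi ih z hz => ?_
  have hza := ha.trans hi hz
  exact (ha.mem hza).mem_of_incl_of_mem (hF i hi) (ih z hza hz) (mono z i hza hi hz)

open Classical in
/-- On a regular successor cardinal, a regressive function has an unbounded fibre: otherwise
iterating a bound for the fibres `ω` times yields an ordinal closed under it, on which the function
cannot be regressive. -/
theorem Reg.exists_unb_fibre (hc : IsOrd c) (hω : Incl omega c) (hr : Reg (hartogs c)) {F : M → M}
    [DefFun₁ F] (hF : ∀ a, a ∈ᴹ hartogs c → a ≠ emp → F a ∈ᴹ a) :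
    ∃ b, b ∈ᴹ hartogs c ∧ Unb (hartogs c) fun a => F a = b := by
  have hm := isOrd_hartogs c
  by_contra hcon
  push Not at hcon
  have hb : ∀ x, x ∈ᴹ hartogs c → ∃ y, IsOrd y ∧ y ∈ᴹ hartogs c ∧
      ∀ b, b ∈ᴹ x → ∀ a, a ∈ᴹ hartogs c → F a = b → a ∈ᴹ y := fun x hx => by
    obtain ⟨y, hy, h⟩ := hr.bounded_union hc (cardLE_of_mem_hartogs hx) (R := fun b a => F a = b)
      fun b hb => hcon b (hm.trans hx hb)
    exact ⟨y, hm.mem hy, hy, h⟩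
  let N : M → M := fun x => least fun y => y ∈ᴹ hartogs c ∧
    ∀ b, b ∈ᴹ x → ∀ a, a ∈ᴹ hartogs c → F a = b → a ∈ᴹ y
  have dN : DefFun₁ N := by
    have : DefFun₁ fun x => least fun y => y ∈ᴹ hartogs c ∧
      ∀ b, b ∈ᴹ x → ∀ a, a ∈ᴹ hartogs c → F a = b → a ∈ᴹ y := inferInstance
    exact this
  have hN : ∀ x, x ∈ᴹ hartogs c → N x ∈ᴹ hartogs c ∧
      ∀ b, b ∈ᴹ x → ∀ a, a ∈ᴹ hartogs c → F a = b → a ∈ᴹ N x := fun x hx => by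
    obtain ⟨y, hy, hy'⟩ := hb x hx
    exact (least_spec (P := fun y => y ∈ᴹ hartogs c ∧
      ∀ b, b ∈ᴹ x → ∀ a, a ∈ᴹ hartogs c → F a = b → a ∈ᴹ y) hy hy').2.1
  -- `D 0 = 1` and `D (n + 1) = N (D n)`, the predecessor of `n + 1` being `⋃ (n + 1)`.
  obtain ⟨D, _, hD⟩ := isOrd_omega.isWF.recursion
    fun n h : M => if n = emp then succ emp else N (app h (sUnion n))
  have D0 : D emp = succ emp := by rw [hD _ (mem_omega.2 isNat_emp), if_pos rfl]
  have Ds : ∀ n, IsNat n → D (succ n) = N (D n) := fun n hn => by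
    rw [hD _ (mem_omega.2 hn.succ), if_neg (succ_ne_emp n), hn.1.sUnion_succ,
      app_lam (mem_sep.2 ⟨mem_omega.2 hn, mem_succ_self n⟩)]
  have h0 : emp ∈ᴹ hartogs c := hm.trans (mem_hartogs_self hc) (hω _ (mem_omega.2 isNat_emp))
  have hDm : ∀ n, IsNat n → D n ∈ᴹ hartogs c := fun n hn => by
    refine nat_induction (P := fun n => D n ∈ᴹ hartogs c) ?_ (fun n hn ih => ?_) hn
    · rw [D0]
      exact succ_mem_hartogs hω h0
    · rw [Ds n hn]
      exact (hN _ ih).1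
  let d : M := sUnion (image omega D)
  have hd : ∀ z, z ∈ᴹ d ↔ ∃ n, IsNat n ∧ z ∈ᴹ D n := fun z => by
    simp only [d, mem_sUnion, mem_image, mem_omega]
    exact ⟨fun ⟨_, ⟨n, hn, e⟩, hz⟩ => ⟨n, hn, e ▸ hz⟩, fun ⟨n, hn, hz⟩ => ⟨_, ⟨n, hn, rfl⟩, hz⟩⟩
  have hdo : IsOrd d := isOrd_sUnion fun y hy => by
    obtain ⟨n, hn, rfl⟩ := mem_image.1 hy
    exact hm.mem (hDm n (mem_omega.1 hn))
  have hdm : d ∈ᴹ hartogs c := by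
    obtain ⟨x, hx, h⟩ := hr.bounded_union hc (omega_le hω) (R := fun n a => a = D n) fun n hn =>
      not_unb_iff.2 ⟨succ (D n), succ_mem_hartogs hω (hDm n (mem_omega.1 hn)), fun _ _ e =>
        e ▸ mem_succ_self _⟩
    refine hdo.mem_of_incl_of_mem hm (fun z hz => ?_) hx
    obtain ⟨n, hn, hz⟩ := (hd z).1 hz
    exact (hm.mem hx).trans (h n (mem_omega.2 hn) _ (hDm n hn) rfl) hz
  have hde : emp ∈ᴹ d := (hd _).2 ⟨emp, isNat_emp, D0 ▸ mem_succ_self _⟩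
  obtain ⟨n, hn, h⟩ := (hd _).1 (hF d hdm fun e => not_mem_emp emp (e ▸ hde))
  refine mem_irrefl d ((hd d).2 ⟨succ n, hn.succ, ?_⟩)
  rw [Ds n hn]
  exact (hN _ (hDm n hn)).2 _ h d hdm rfl

theorem Reg.regressive (hc : IsOrd c) (hω : Incl omega c) (hr : Reg (hartogs c)) :
    Regressive (hartogs c) (hartogs c) := by
  rintro f ⟨hf, hreg⟩
  obtain ⟨b, hb, h⟩ := hr.exists_unb_fibre hc hω (F := app f) fun a ha hne =>
    hreg a _ (hf.maps_iff.2 ⟨ha, rfl⟩) (by simpa using hne)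
  refine ⟨b, hb, sep (hartogs c) fun x => Maps f x b, fun x => ?_, ?_⟩
  · rw [mem_sep, and_iff_right_iff_imp]
    exact fun h => (hf.maps_iff.1 h).1
  · refine (Unb.hasOrderType (isOrd_hartogs c) hr (fun x hx => (mem_sep.1 hx).1)
      (h.mono fun x hx e => ?_)).cardEq.le
    exact mem_sep.2 ⟨hx, hf.maps_iff.2 ⟨hx, e.symm⟩⟩

/-- If `c⁺` is singular, then it is the union of an increasing sequence of fewer than `c⁺` bounded
pieces. The index function `I` is what the counterexamples to the other properties are built from.
-/
theorem exists_index_of_not_reg (hω : Incl omega c) (hr : ¬ Reg (hartogs c)) :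
    ∃ (d : M) (I : M → M), d ∈ᴹ hartogs c ∧ DefFun₁ I ∧ (∀ a, a ∈ᴹ hartogs c → I a ∈ᴹ d) ∧
      (∀ a b, a ∈ᴹ hartogs c → b ∈ᴹ hartogs c → a ∈ᴹ b → Incl (I a) (I b)) ∧
      ∀ i, ¬ Unb (hartogs c) fun a => I a = i := by
  unfold Reg at hr
  push Not at hr
  obtain ⟨d, hd, h⟩ := hr
  have hm := isOrd_hartogs c
  obtain ⟨I, h1, h2, h3, h4⟩ := h.exists_index hm (hm.mem hd) fun x hx => succ_mem_hartogs hω hx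
  refine ⟨d, I, hd, h1, h2, h3, fun i hi => ?_⟩
  obtain ⟨a, ha, rfl, -⟩ := hi d hd
  exact not_unb_iff.2 (h4 _ (h2 a ha)) hi

theorem not_unb_not_mem (hω : Incl omega c) {d : M} (hd : d ∈ᴹ hartogs c) :
    ¬ Unb (hartogs c) fun a => ¬ d ∈ᴹ a :=
  have hm := isOrd_hartogs c
  not_unb_iff.2 ⟨succ d, succ_mem_hartogs hω hd, fun _ hy h =>
    ((hm.mem hy).mem_succ_iff (hm.mem hd)).2 (((hm.mem hd).not_mem_iff (hm.mem hy)).1 h)⟩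

theorem not_unb_eq (hω : Incl omega c) (d : M) : ¬ Unb (hartogs c) fun a => a = d := fun h => by
  obtain ⟨y, hy, rfl, -⟩ := h _ emp_mem_hartogs
  exact not_unb_not_mem hω hy (h.mono fun x _ e => by
    subst e
    exact mem_irrefl x)

open Classical in
/-- If `c⁺` is singular, then the index function of the pieces, set to `0` at and below the number
`d` of pieces, is regressive with bounded fibres. -/
theorem Regressive.reg (hω : Incl omega c) (h : Regressive (hartogs c) (hartogs c)) :
    Reg (hartogs c) := by
  by_contra hr
  obtain ⟨d, I, hd, _, hI, -, hb⟩ := exists_index_of_not_reg hω hr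
  have hm := isOrd_hartogs c
  have hF : IsFun (lam (hartogs c) fun a => if d ∈ᴹ a then I a else emp) (hartogs c) (hartogs c) :=
      by
    refine isFun_lam fun a ha => ?_
    split_ifs
    exacts [hm.trans hd (hI a ha), emp_mem_hartogs]
  obtain ⟨b, hb', B, hB, hle⟩ := h _ ⟨hF, fun a b hab hne => by
    rw [maps_lam] at hab
    obtain ⟨ha, rfl⟩ := hab
    rw [isEmptySet_iff] at hne
    split_ifs with hda
    exacts [(hm.mem ha).trans hda (hI a ha), (hm.mem ha).eq_emp_or.resolve_left hne]⟩
  have hu := unb_of_cardLE (fun x hx => (maps_lam.1 ((hB x).1 hx)).1) hle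
  rcases Unb.or hm (S := fun a => ¬ d ∈ᴹ a) (T := fun a => I a = b) (hu.mono fun x _ hx => by
    have := (maps_lam.1 ((hB x).1 hx)).2
    by_cases hdx : d ∈ᴹ x
    · rw [if_pos hdx] at this
      exact .inr this.symm
    · exact .inl hdx) with h | h
  exacts [not_unb_not_mem hω hd h, hb b h]

/-! ### Delta-systems -/

theorem isFinite_emp : IsFinite (emp : M) := ⟨emp, isNat_emp, cardEq_refl _⟩

open Classical in
theorem IsFinite.insert {X : M} (h : IsFinite X) (a : M) : IsFinite (union X (upair a a)) := by
  by_cases ha : a ∈ᴹ X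
  · have : union X (upair a a) = X := by
      ext z
      simp only [mem_union, mem_upair, or_self, or_iff_left_iff_imp]
      rintro rfl
      exact ha
    rwa [this]
  · obtain ⟨n, hn, hX⟩ := h
    obtain ⟨F, _, hF, inj, surj⟩ := hX.elim
    refine ⟨succ n, hn.succ, .intro (fun x => if x = a then n else F x) (fun x hx => ?_)
      (fun x y hx hy e => ?_) fun y hy => ?_⟩
    · simp only [mem_union, mem_upair, or_self] at hx
      split_ifs with h
      exacts [mem_succ_self n, mem_succ.2 (.inl (hF x (hx.resolve_right h)))]
    · simp only [mem_union, mem_upair, or_self] at hx hy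
      split_ifs at e with h1 h2 h2
      · rw [h1, h2]
      · exact absurd (e ▸ hF y (hy.resolve_right h2)) (mem_irrefl _)
      · exact absurd (e ▸ hF x (hx.resolve_right h1)) (mem_irrefl _)
      · exact inj x y (hx.resolve_right h1) (hy.resolve_right h2) e
    · rcases mem_succ.1 hy with hy | rfl
      · obtain ⟨x, hx, rfl⟩ := surj y hy
        refine ⟨x, by simp [hx], ?_⟩
        have hne : x ≠ a := fun e => ha (e ▸ hx)
        rw [if_neg hne]
      · exact ⟨a, by simp, by rw [if_pos rfl]⟩

theorem isFinite_upair (a b : M) : IsFinite (upair a b) := by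
  have : upair a b = union (union emp (upair a a)) (upair b b) := by ext z; simp
  rw [this]
  exact (isFinite_emp.insert a).insert b

/-- If `c⁺` is singular with index function `I`, then the sets `{I a, a}` contain no large
Delta-system: a nonempty root confines `a` to a bounded set, and an empty root makes `I` injective
on it. -/
theorem DeltaArrow.reg (hω : Incl omega c) (h : DeltaArrow (hartogs c) (hartogs c)) :
    Reg (hartogs c) := by
  by_contra hr
  obtain ⟨d, I, hd, _, hI, hmono, hb⟩ := exists_index_of_not_reg hω hr
  have hm := isOrd_hartogs c
  have hIm : ∀ a, a ∈ᴹ hartogs c → IsOrd (I a) := fun a ha => (hm.mem hd).mem (hI a ha)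
  have inj : ∀ a b, a ∈ᴹ hartogs c → b ∈ᴹ hartogs c → upair (I a) a = upair (I b) b → a = b := by
    intro a b ha hb e
    rcases upair_eq_iff.1 e with ⟨-, e⟩ | ⟨e1, e2⟩
    · exact e
    · rcases hm.2 a b ha hb with h | h | h
      · have := hmono a b ha hb h
        rw [e1, ← e2] at this
        exact absurd (this a h) (mem_irrefl a)
      · exact h
      · have := hmono b a hb ha h
        rw [e1, ← e2] at this
        exact absurd (this b h) (mem_irrefl b)
  obtain ⟨B, hBA, ⟨r, hr⟩, hBm⟩ := h (image (hartogs c) fun a => upair (I a) a) (fun x hx => by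
    obtain ⟨a, ha, rfl⟩ := mem_image.1 hx
    refine ⟨isFinite_upair _ _, fun z hz => ?_⟩
    rcases mem_upair.1 hz with rfl | rfl
    exacts [hIm a ha, hm.mem ha])
    (CardEq.symm (.intro (fun a => upair (I a) a) (fun x hx => mem_image.2 ⟨x, hx, rfl⟩) inj
      fun y hy => mem_image.1 hy))
  let K : M := sep (hartogs c) fun a => upair (I a) a ∈ᴹ B
  have hK : ∀ a, a ∈ᴹ K ↔ a ∈ᴹ hartogs c ∧ upair (I a) a ∈ᴹ B := fun a => mem_sep
  have hle : CardLE (hartogs c) K := by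
    refine hBm.symm.le.trans ?_
    have key : ∀ x, x ∈ᴹ B → ∃! a, a ∈ᴹ hartogs c ∧ x = upair (I a) a := fun x hx => by
      obtain ⟨a, ha, e⟩ := mem_image.1 (hBA x hx)
      exact ⟨a, ⟨ha, e⟩, fun b hb => inj b a hb.1 ha (hb.2.symm.trans e)⟩
    refine .intro (fun x => the fun a => a ∈ᴹ hartogs c ∧ x = upair (I a) a) (fun x hx => ?_)
      fun x y hx hy e => ?_
    · have := the_spec (key x hx)
      exact (hK _).2 ⟨this.1, this.2 ▸ hx⟩
    · beta_reduce at e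
      rw [(the_spec (key x hx)).2, e, ← (the_spec (key y hy)).2]
  have hu := unb_of_cardLE (fun x hx => ((hK x).1 hx).1) hle
  by_cases hr0 : ∃ z, z ∈ᴹ r
  · obtain ⟨z, hz⟩ := hr0
    have hzK : ∀ a, a ∈ᴹ K → z = I a ∨ z = a := fun a ha => by
      have ha' := (hK a).1 ha
      obtain ⟨b, hb, hbK, hba⟩ := hu _ (succ_mem_hartogs hω ha'.1)
      have hb' := (hK b).1 hbK
      refine mem_upair.1 ((hr _ _ ha'.2 hb'.2 (fun e => hba ?_) z).1 hz).1
      rw [inj a b ha'.1 hb e]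
      exact mem_succ_self b
    rcases Unb.or hm (hu.mono fun x _ hx => hzK x hx) with h | h
    · exact hb z (h.mono fun x _ e => e.symm)
    · exact not_unb_eq hω z (h.mono fun x _ e => e.symm)
  · refine not_hartogs_le c (hle.trans (CardLE.trans ?_ (cardLE_of_mem_hartogs hd)))
    refine .intro I (fun x hx => hI x ((hK x).1 hx).1) fun a b ha hb e => ?_
    have ha' := (hK a).1 ha
    have hb' := (hK b).1 hb
    by_contra hne
    exact hr0 ⟨I a, (hr _ _ ha'.2 hb'.2 (fun e => hne (inj a b ha'.1 hb'.1 e)) _).2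
      ⟨by simp, by simp [e]⟩⟩

/-- The set difference. -/
noncomputable def diff (x y : M) : M := sep x fun z => ¬ z ∈ᴹ y

instance : DefFun₂ (diff (M := M)) := ⟨by unfold diff; infer_instance⟩

@[simp] theorem mem_diff {x y z : M} : z ∈ᴹ diff x y ↔ z ∈ᴹ x ∧ ¬ z ∈ᴹ y := mem_sep

open Classical in
/-- Removing a point from a set with at most `n + 1` elements leaves at most `n` elements: an
injection to `n + 1` is changed to send the preimage of `n` to the value of the removed point. -/
theorem CardLE.erase {X Y n a : M} (h : CardLE X (succ n)) (ha : a ∈ᴹ X) (hY : Incl Y X)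
    (haY : ¬ a ∈ᴹ Y) : CardLE Y n := by
  obtain ⟨F, _, hF, inj⟩ := h.elim
  refine .intro (fun x => if F x = n then F a else F x) (fun x hx => ?_) fun x y hx hy e => ?_
  · have hxa : x ≠ a := fun e => haY (e ▸ hx)
    split_ifs with h
    · refine (mem_succ.1 (hF a ha)).resolve_right fun e =>
        hxa (inj x a (hY x hx) ha (h.trans e.symm))
    · exact (mem_succ.1 (hF x (hY x hx))).resolve_right h
  · have hxa : x ≠ a := fun e => haY (e ▸ hx)
    have hya : y ≠ a := fun e => haY (e ▸ hy)
    have h1 := inj x y (hY x hx) (hY y hy)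
    have h2 := inj x a (hY x hx) ha
    have h3 := inj y a (hY y hy) ha
    split_ifs at e <;> grind

open Classical in
/-- On a regular successor cardinal every family of finite sets contains a large Delta-system. The
root `r` is chosen so that the finite sets `A \ r` are as small as possible on a large subfamily;
then no further point lies in many members, and the regressive function which sends an index to the
first earlier index of a member that meets it outside `r` shows that many members have no such
earlier index. -/
theorem Reg.deltaArrow (hc : IsOrd c) (hω : Incl omega c) (hr : Reg (hartogs c)) :
    DeltaArrow (hartogs c) (hartogs c) := by
  intro A hA hAm
  have hm := isOrd_hartogs c
  obtain ⟨E, _, hE, injE, -⟩ := hAm.symm.elim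
  -- Some `l` occurs for the root `∅`, by pigeonhole on the sizes of the members.
  obtain ⟨l, -, ⟨hl, r, hu⟩, hmin⟩ : ∃ l, IsOrd l ∧ (IsNat l ∧ ∃ r, Unb (hartogs c) fun a =>
      Incl r (E a) ∧ CardLE (diff (E a) r) l) ∧ ∀ k, k ∈ᴹ l → ¬ (IsNat k ∧ ∃ r,
          Unb (hartogs c) fun a =>
      Incl r (E a) ∧ CardLE (diff (E a) r) k) := by
    have hall : Unb (hartogs c) fun _ => True := fun x hx => ⟨x, hx, trivial, mem_irrefl x⟩
    obtain ⟨n, hn, hu⟩ := hall.pigeonhole hc hr (omega_le hω) (R := fun n a => CardLE (E a) n)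
      fun a ha _ => by
        obtain ⟨n, hn, h⟩ := (hA _ (hE a ha)).1
        exact ⟨n, mem_omega.2 hn, h.le⟩
    rw [mem_omega] at hn
    have : DefRel₁ fun l => IsNat l ∧ ∃ r, Unb (hartogs c) fun a =>
        Incl r (E a) ∧ CardLE (diff (E a) r) l := by
      unfold Unb
      infer_instance
    refine exists_least (P := fun l => IsNat l ∧ ∃ r, Unb (hartogs c) fun a =>
      Incl r (E a) ∧ CardLE (diff (E a) r) l) hn.1 ⟨hn, emp, hu.mono fun a _ h =>
      ⟨fun z hz => absurd hz (not_mem_emp z), ?_⟩⟩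
    exact (CardLE.of_incl fun z hz => (mem_diff.1 hz).1).trans h.2
  have hpt : ∀ z, ¬ z ∈ᴹ r → ¬ Unb (hartogs c) fun a =>
      (Incl r (E a) ∧ CardLE (diff (E a) r) l) ∧ z ∈ᴹ E a := by
    intro z hz hu'
    rcases hl.cases with rfl | ⟨k, hk, rfl⟩
    · obtain ⟨a, ha, ⟨⟨-, hle⟩, hza⟩, -⟩ := hu' c (mem_hartogs_self hc)
      obtain ⟨G, _, hG, -⟩ := hle.elim
      exact not_mem_emp _ (hG z (mem_diff.2 ⟨hza, hz⟩))
    · refine hmin k (mem_succ_self k) ⟨hk, union r (upair z z), hu'.mono fun a ha h => ⟨?_, ?_⟩⟩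
      · intro t ht
        simp only [mem_union, mem_upair, or_self] at ht
        rcases ht with ht | rfl
        exacts [h.1.1 t ht, h.2]
      · refine h.1.2.erase (mem_diff.2 ⟨h.2, hz⟩) (fun t ht => ?_) fun hz' => ?_
        · simp only [mem_diff, mem_union, not_or] at ht ⊢
          exact ⟨ht.1, ht.2.1⟩
        · simp at hz'
  -- Reindexing by `G` makes the subfamily a family indexed by `c⁺` itself, as regressive functions
  -- need; `a ≤ G a` keeps unbounded sets of indices unbounded.
  obtain ⟨G, _, hG, monoG, -⟩ := (Unb.hasOrderType hm hr
    (S := sep (hartogs c) fun a => Incl r (E a) ∧ CardLE (diff (E a) r) l)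
    (fun x hx => (mem_sep.1 hx).1) (hu.mono fun x hx h => mem_sep.2 ⟨hx, h⟩)).elim
  simp only [mem_sep] at hG
  have injG : ∀ a b, a ∈ᴹ hartogs c → b ∈ᴹ hartogs c → E (G a) = E (G b) → a = b :=
      fun a b ha hb e => by
    have e := injE _ _ (hG a ha).1 (hG b hb).1 e
    rcases hm.2 a b ha hb with h | h | h
    · exact absurd (e ▸ monoG a b ha hb h) (mem_irrefl _)
    · exact h
    · exact absurd (e ▸ monoG b a hb ha h) (mem_irrefl _)
  have hGle := hm.incl_of_increasing (F := G) (fun i hi => hm.mem (hG i hi).1) monoG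
  have hpt' : ∀ z, ¬ z ∈ᴹ r → ¬ Unb (hartogs c) fun a => z ∈ᴹ E (G a) := fun z hz hu' => by
    refine hpt z hz fun x hx => ?_
    obtain ⟨a, ha, hza, hax⟩ := hu' x hx
    exact ⟨G a, (hG a ha).1, ⟨(hG a ha).2, hza⟩, fun h => hax
      ((hm.mem ha).mem_of_incl_of_mem (hm.mem hx) (hGle a ha) h)⟩
  let Meet : M → M → Prop := fun a b => ∃ z, z ∈ᴹ E (G a) ∧ z ∈ᴹ E (G b) ∧ ¬ z ∈ᴹ r
  have dMeet : DefRel₂ Meet := by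
    have : DefRel₂ fun a b => ∃ z, z ∈ᴹ E (G a) ∧ z ∈ᴹ E (G b) ∧ ¬ z ∈ᴹ r := inferInstance
    exact this
  have hU : Unb (hartogs c) fun a => ∀ b, b ∈ᴹ a → ¬ Meet a b := by
    have spec : ∀ a, a ∈ᴹ hartogs c → ∀ b, b ∈ᴹ a → Meet a b →
        (least fun b => b ∈ᴹ a ∧ Meet a b) ∈ᴹ a ∧ Meet a (least fun b => b ∈ᴹ a ∧ Meet a b) :=
      fun a ha b hb hab => (least_spec (P := fun b => b ∈ᴹ a ∧ Meet a b) ((hm.mem ha).mem hb) ⟨hb,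
          hab⟩).2.1
    obtain ⟨b, hb, hu⟩ := hr.exists_unb_fibre hc hω
      (F := fun a => if ∃ b, b ∈ᴹ a ∧ Meet a b then least fun b => b ∈ᴹ a ∧ Meet a b else emp)
      fun a ha hne => by
        split_ifs with h
        · obtain ⟨b, hb, hab⟩ := h
          exact (spec a ha b hb hab).1
        · exact (hm.mem ha).eq_emp_or.resolve_left hne
    rcases Unb.or hm (S := fun a => ∀ b, b ∈ᴹ a → ¬ Meet a b) (T := fun a => Meet a b)
      (hu.mono fun a ha e => by
        split_ifs at e with h
        · obtain ⟨b', hb', hab⟩ := h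
          exact .inr (e ▸ (spec a ha b' hb' hab).2)
        · push Not at h
          exact .inl h) with h | h
    · exact h
    · exfalso
      obtain ⟨z, hz, hu'⟩ := h.pigeonhole hc hr (Y := diff (E (G b)) r) ((hG b hb).2.2.trans
        ((CardLE.of_incl (isOrd_omega.1 l (mem_omega.2 hl))).trans (omega_le hω)))
        (R := fun z a => z ∈ᴹ E (G a)) fun a ha ⟨z, h1, h2, h3⟩ => ⟨z, mem_diff.2 ⟨h2, h3⟩, h1⟩
      exact hpt' z (mem_diff.1 hz).2 (hu'.mono fun a _ h => h.2)
  let U : M := sep (hartogs c) fun a => ∀ b, b ∈ᴹ a → ¬ Meet a b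
  have hUm : ∀ a, a ∈ᴹ U ↔ a ∈ᴹ hartogs c ∧ ∀ b, b ∈ᴹ a → ¬ Meet a b := fun a => mem_sep
  have hUc : CardEq (hartogs c) U := (Unb.hasOrderType hm hr (fun x hx => ((hUm x).1 hx).1)
    (hU.mono fun x hx h => (hUm x).2 ⟨hx, h⟩)).cardEq
  refine ⟨image U fun a => E (G a), fun x hx => ?_, ⟨r, fun x y hx hy hne z => ?_⟩,
    CardEq.trans (CardEq.symm ?_) hUc.symm⟩
  · obtain ⟨a, ha, rfl⟩ := mem_image.1 hx
    exact hE _ (hG a ((hUm a).1 ha).1).1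
  · obtain ⟨a, ha, rfl⟩ := mem_image.1 hx
    obtain ⟨b, hb, rfl⟩ := mem_image.1 hy
    rw [hUm] at ha hb
    refine ⟨fun hz => ⟨(hG a ha.1).2.1 z hz, (hG b hb.1).2.1 z hz⟩, fun hz => ?_⟩
    by_contra hzr
    rcases hm.2 a b ha.1 hb.1 with h | rfl | h
    · exact hb.2 a h ⟨z, hz.2, hz.1, hzr⟩
    · exact hne rfl
    · exact ha.2 b h ⟨z, hz.1, hz.2, hzr⟩
  · exact .intro (fun a => E (G a)) (fun x hx => mem_image.2 ⟨x, hx, rfl⟩) (fun a b ha hb e =>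
      injG a b ((hUm a).1 ha).1 ((hUm b).1 hb).1 e) fun y hy => mem_image.1 hy

end Regressive

section Trees

variable {M : Type u} [LSet.Structure M] [ZF M] {c : M}

/-! ### Finite sequences of ordinals -/

/-- The extension of the sequence `s` of length `n` by the term `a`. -/
noncomputable def snoc (s n a : M) : M := union s (upair (pair n a) (pair n a))

@[simp] theorem mem_snoc {s n a p : M} : p ∈ᴹ snoc s n a ↔ p ∈ᴹ s ∨ p = pair n a := by simp [snoc]

theorem IsOrdSeq.isFun {s n : M} (h : IsOrdSeq s n) :
    (∀ p, p ∈ᴹ s → ∃ i, i ∈ᴹ n ∧ IsOrd (app s i) ∧ p = pair i (app s i)) ∧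
      ∀ i, i ∈ᴹ n → pair i (app s i) ∈ᴹ s ∧ IsOrd (app s i) := by
  have h1 : ∀ i, i ∈ᴹ n → pair i (app s i) ∈ᴹ s := fun i hi =>
      maps_iff_mem.1 (the_spec (h.2.2 i hi))
  have h2 : ∀ p, p ∈ᴹ s → ∃ i, i ∈ᴹ n ∧ IsOrd (app s i) ∧ p = pair i (app s i) := fun p hp => by
    obtain ⟨i, a, hi, ha, e⟩ := h.2.1 p hp
    rw [isPair_iff] at e
    have : app s i = a := the_eq (h.2.2 i hi) (maps_iff_mem.2 (e ▸ hp))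
    exact ⟨i, hi, this ▸ ha, this ▸ e⟩
  refine ⟨h2, fun i hi => ⟨h1 i hi, ?_⟩⟩
  obtain ⟨j, -, ho, e⟩ := h2 _ (h1 i hi)
  rw [pair_inj] at e
  exact e.2 ▸ ho

theorem IsOrdSeq.mem_iff {s n i a : M} (h : IsOrdSeq s n) :
    pair i a ∈ᴹ s ↔ i ∈ᴹ n ∧ a = app s i := by
  constructor
  · intro hp
    obtain ⟨j, hj, -, e⟩ := h.isFun.1 _ hp
    obtain ⟨rfl, rfl⟩ := pair_inj.1 e
    exact ⟨hj, rfl⟩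
  · rintro ⟨hi, rfl⟩
    exact (h.isFun.2 i hi).1

theorem IsOrdSeq.ext {s t n : M} (hs : IsOrdSeq s n) (ht : IsOrdSeq t n)
    (h : ∀ i, i ∈ᴹ n → app s i = app t i) : s = t := by
  refine ZFModel.ext fun p => ⟨fun hp => ?_, fun hp => ?_⟩
  · obtain ⟨i, hi, -, rfl⟩ := hs.isFun.1 p hp
    exact ht.mem_iff.2 ⟨hi, h i hi⟩
  · obtain ⟨i, hi, -, rfl⟩ := ht.isFun.1 p hp
    exact hs.mem_iff.2 ⟨hi, (h i hi).symm⟩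

theorem IsOrdSeq.app_eq_of_incl {s t n m : M} (hs : IsOrdSeq s n) (ht : IsOrdSeq t m)
    (h : Incl s t) {i : M} (hi : i ∈ᴹ n) : i ∈ᴹ m ∧ app s i = app t i :=
  ht.mem_iff.1 (h _ (hs.isFun.2 i hi).1)

theorem IsOrdSeq.length_unique {s n m : M} (hs : IsOrdSeq s n) (ht : IsOrdSeq s m) : n = m :=
  ZFModel.ext fun _ => ⟨fun hi => (hs.app_eq_of_incl ht (incl_refl s) hi).1,
    fun hi => (ht.app_eq_of_incl hs (incl_refl s) hi).1⟩

theorem isOrdSeq_emp : IsOrdSeq (emp : M) emp :=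
  ⟨isNat_emp, fun p hp => absurd hp (not_mem_emp p), fun i hi => absurd hi (not_mem_emp i)⟩

theorem IsOrdSeq.snoc {s n a : M} (h : IsOrdSeq s n) (ha : IsOrd a) :
    IsOrdSeq (snoc s n a) (succ n) := by
  refine ⟨h.1.succ, fun p hp => ?_, fun i hi => ?_⟩
  · rcases mem_snoc.1 hp with hp | rfl
    · obtain ⟨i, b, hi, hb, e⟩ := h.2.1 p hp
      exact ⟨i, b, mem_succ.2 (.inl hi), hb, e⟩
    · exact ⟨n, a, mem_succ_self n, ha, by simp⟩
  · simp only [maps_iff_mem, mem_snoc, pair_inj]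
    rcases mem_succ.1 hi with hi | rfl
    · refine ⟨app s i, .inl (h.mem_iff.2 ⟨hi, rfl⟩), fun b hb => ?_⟩
      rcases hb with hb | ⟨rfl, -⟩
      exacts [(h.mem_iff.1 hb).2, absurd hi (mem_irrefl _)]
    · refine ⟨a, .inr ⟨rfl, rfl⟩, fun b hb => ?_⟩
      rcases hb with hb | ⟨-, rfl⟩
      exacts [absurd (h.mem_iff.1 hb).1 (mem_irrefl _), rfl]

theorem snoc_inj {s t n m a b : M} (hs : IsOrdSeq s n) (ht : IsOrdSeq t m) (ha : IsOrd a)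
    (hb : IsOrd b) (e : snoc s n a = snoc t m b) : s = t ∧ n = m ∧ a = b := by
  have hl : n = m := succ_inj.1 ((hs.snoc ha).length_unique (e ▸ ht.snoc hb))
  subst hl
  have hsn : ∀ p, p ∈ᴹ s → p ∈ᴹ t := fun p hp => by
    have : p ∈ᴹ snoc t n b := e ▸ mem_snoc.2 (.inl hp)
    refine (mem_snoc.1 this).resolve_right fun e' => ?_
    exact mem_irrefl n (hs.mem_iff.1 (e' ▸ hp)).1
  have htn : ∀ p, p ∈ᴹ t → p ∈ᴹ s := fun p hp => by
    have : p ∈ᴹ snoc s n a := e ▸ mem_snoc.2 (.inl hp)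
    refine (mem_snoc.1 this).resolve_right fun e' => ?_
    exact mem_irrefl n (ht.mem_iff.1 (e' ▸ hp)).1
  refine ⟨ZFModel.ext fun p => ⟨hsn p, htn p⟩, rfl, ?_⟩
  have : pair n a ∈ᴹ snoc t n b := e ▸ mem_snoc.2 (.inr rfl)
  rcases mem_snoc.1 this with h | h
  · exact absurd (ht.mem_iff.1 h).1 (mem_irrefl n)
  · exact (pair_inj.1 h).2

theorem isAppend_iff {s a t : M} : IsAppend s a t ↔ ∃ n, IsOrdSeq s n ∧ t = snoc s n a := by
  unfold IsAppend
  refine exists_congr fun n => ⟨?_, ?_⟩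
  · rintro ⟨p, hs, hp, h⟩
    rw [isPair_iff] at hp
    subst hp
    exact ⟨hs, ZFModel.ext fun q => by rw [h, mem_snoc]⟩
  · rintro ⟨hs, rfl⟩
    exact ⟨_, hs, isPair_iff.2 rfl, fun q => mem_snoc⟩

/-- An initial segment of a one-term extension of `s` is all of it or an initial segment of `s`. -/
theorem IsOrdSeq.incl_snoc {s t n m a : M} (hs : IsOrdSeq s n) (ht : IsOrdSeq t m)
    (h : Incl t (ZFModel.snoc s n a)) : t = ZFModel.snoc s n a ∨ Incl t s := by
  by_cases hp : pair n a ∈ᴹ t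
  · left
    have hnm := (ht.mem_iff.1 hp).1
    refine h.antisymm fun p hp' => ?_
    rcases mem_snoc.1 hp' with hp' | rfl
    · obtain ⟨i, hi, -, rfl⟩ := hs.isFun.1 p hp'
      have him := ht.1.1.trans hnm hi
      have := mem_snoc.1 (h _ (ht.isFun.2 i him).1)
      rcases this with h1 | h1
      · rw [← (hs.mem_iff.1 h1).2]
        exact (ht.isFun.2 i him).1
      · exact absurd ((pair_inj.1 h1).1 ▸ hi) (mem_irrefl _)
    · exact hp
  · right
    intro p hp'
    exact (mem_snoc.1 (h p hp')).resolve_right fun e => hp (e ▸ hp')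

/-! ### Trees -/

/-- If `c⁺` is singular with index function `I`, then the initial segments of the sequences `(I a,
a)` form a tree with `c⁺` nodes in which every node has fewer than `c⁺` immediate successors. -/
theorem TreeBound.reg (hω : Incl omega c) (h : TreeBound (hartogs c) c) : Reg (hartogs c) := by
  by_contra hr
  obtain ⟨d, I, hd, _, hI, -, hb⟩ := exists_index_of_not_reg hω hr
  have hm := isOrd_hartogs c
  have hdo := hm.mem hd
  let s1 : M → M := fun i => snoc emp emp i
  let s2 : M → M := fun a => snoc (s1 (I a)) (succ emp) a
  have ds1 : DefFun₁ s1 := by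
    have : DefFun₁ fun i : M => union emp (upair (pair emp i) (pair emp i)) := inferInstance
    exact this
  have ds2 : DefFun₁ s2 := by
    have : DefFun₁ fun a : M => union (s1 (I a)) (upair (pair (succ emp) a) (pair (succ emp) a)) :=
      inferInstance
    exact this
  have hs1 : ∀ i, IsOrd i → IsOrdSeq (s1 i) (succ emp) := fun i hi => isOrdSeq_emp.snoc hi
  have hIo : ∀ a, a ∈ᴹ hartogs c → IsOrd (I a) := fun a ha => hdo.mem (hI a ha)
  have hs2 : ∀ a, a ∈ᴹ hartogs c → IsOrdSeq (s2 a) (succ (succ emp)) := fun a ha =>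
    (hs1 _ (hIo a ha)).snoc (hm.mem ha)
  let T : M := union (union (upair emp emp) (image d s1)) (image (hartogs c) s2)
  have hT : ∀ t, t ∈ᴹ T ↔ (t = emp ∨ ∃ i, i ∈ᴹ d ∧ t = s1 i) ∨ ∃ a, a ∈ᴹ hartogs c ∧ t = s2 a :=
    fun t => by simp only [T, mem_union, mem_upair, or_self, mem_image]
  have tree : IsTree T := by
    refine ⟨fun t ht => ?_, fun t s ht ⟨n, hs⟩ hst => ?_⟩
    · rcases (hT t).1 ht with (rfl | ⟨i, hi, rfl⟩) | ⟨a, ha, rfl⟩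
      exacts [⟨_, isOrdSeq_emp⟩, ⟨_, hs1 i (hdo.mem hi)⟩, ⟨_, hs2 a ha⟩]
    · have h0 : Incl s emp → s = emp := fun h => h.antisymm fun z hz => absurd hz (not_mem_emp z)
      have h1 : ∀ i, i ∈ᴹ d → Incl s (s1 i) → s = s1 i ∨ s = emp := fun i hi h =>
        (isOrdSeq_emp.incl_snoc hs h).imp_right h0
      rw [hT]
      rcases (hT t).1 ht with (rfl | ⟨i, hi, rfl⟩) | ⟨a, ha, rfl⟩
      · exact .inl (.inl (h0 hst))
      · rcases h1 i hi hst with h | h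
        exacts [.inl (.inr ⟨i, hi, h⟩), .inl (.inl h)]
      · rcases (hs1 _ (hIo a ha)).incl_snoc hs hst with h | h
        · exact .inr ⟨a, ha, h⟩
        · rcases h1 _ (hI a ha) h with h | h
          exacts [.inl (.inr ⟨_, hI a ha, h⟩), .inl (.inl h)]
  have branch : IsBranchingLT T (hartogs c) := by
    intro s hs
    -- Every immediate successor of `s` is determined by an ordinal below `c⁺`, and these ordinals
    -- are bounded.
    have key : ∃ x, x ∈ᴹ hartogs c ∧ ∀ a t, IsOrd a → t ∈ᴹ T → IsAppend s a t → a ∈ᴹ x := by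
      have hlen : ∀ {n a t}, IsOrdSeq s n → IsOrd a → t = snoc s n a → t ∈ᴹ T →
          (s = emp ∧ a ∈ᴹ d) ∨ (a ∈ᴹ hartogs c ∧ s = s1 (I a)) := by
        intro n a t hsn ha e ht
        rcases (hT t).1 ht with (rfl | ⟨i, hi, rfl⟩) | ⟨b, hb, rfl⟩
        · have : pair n a ∈ᴹ snoc s n a := mem_snoc.2 (.inr rfl)
          exact absurd (e ▸ this) (not_mem_emp _)
        · obtain ⟨h1, -, h2⟩ := snoc_inj isOrdSeq_emp hsn (hdo.mem hi) ha e
          exact .inl ⟨h1.symm, h2 ▸ hi⟩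
        · obtain ⟨h1, -, h2⟩ := snoc_inj (hs1 _ (hIo b hb)) hsn (hm.mem hb) ha e
          subst h2
          exact .inr ⟨hb, h1.symm⟩
      by_cases he : s = emp
      · refine ⟨d, hd, fun a t ha ht hst => ?_⟩
        obtain ⟨n, hsn, e⟩ := isAppend_iff.1 hst
        rcases hlen hsn ha e ht with h | ⟨-, h⟩
        · exact h.2
        · have : pair emp (I a) ∈ᴹ s1 (I a) := mem_snoc.2 (.inr rfl)
          exact absurd (he ▸ h ▸ this) (not_mem_emp _)
      · by_cases hi : ∃ i, i ∈ᴹ d ∧ s = s1 i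
        · obtain ⟨i, hi, rfl⟩ := hi
          obtain ⟨x, hx, hxI⟩ := not_unb_iff.1 (hb i)
          refine ⟨x, hx, fun a t ha ht hst => ?_⟩
          obtain ⟨n, hsn, e⟩ := isAppend_iff.1 hst
          rcases hlen hsn ha e ht with h | ⟨h, h'⟩
          · exact absurd h.1 he
          · exact hxI a h (snoc_inj isOrdSeq_emp isOrdSeq_emp (hdo.mem hi) (hIo a h) h').2.2.symm
        · refine ⟨d, hd, fun a t ha ht hst => ?_⟩
          obtain ⟨n, hsn, e⟩ := isAppend_iff.1 hst
          rcases hlen hsn ha e ht with h | ⟨h, h'⟩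
          · exact absurd h.1 he
          · exact absurd ⟨_, hI a h, h'⟩ hi
    obtain ⟨x, hx, hxs⟩ := key
    refine ⟨sep x fun a => IsOrd a ∧ ∃ t, t ∈ᴹ T ∧ IsAppend s a t, fun a => ?_, ?_⟩
    · rw [mem_sep, and_iff_right_iff_imp]
      rintro ⟨ha, t, ht, hst⟩
      exact hxs a t ha ht hst
    · have hle : CardLE (sep x fun a => IsOrd a ∧ ∃ t, t ∈ᴹ T ∧ IsAppend s a t) x :=
        .of_incl fun z hz => (mem_sep.1 hz).1
      refine ⟨hle.trans (.of_incl (hm.1 x hx)), fun heq => not_hartogs_le c ?_⟩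
      exact heq.symm.le.trans (hle.trans (cardLE_of_mem_hartogs hx))
  refine not_hartogs_le c (CardLE.trans ?_ (h T tree branch))
  exact .intro s2 (fun a ha => (hT _).2 (.inr ⟨a, ha, rfl⟩)) fun a b ha hb e =>
    (snoc_inj (hs1 _ (hIo a ha)) (hs1 _ (hIo b hb)) (hm.mem ha) (hm.mem hb) e).2.2

/-- The length of a sequence. -/
noncomputable def len (s : M) : M := the fun n => IsOrdSeq s n

instance : DefFun₁ (len (M := M)) := ⟨by unfold len; infer_instance⟩

theorem IsOrdSeq.len_eq {s n : M} (h : IsOrdSeq s n) : len s = n :=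
  the_eq ⟨n, h, fun _ hm => hm.length_unique h⟩ h

theorem IsFinOrdSeq.isOrdSeq {s : M} (h : IsFinOrdSeq s) : IsOrdSeq s (len s) := by
  obtain ⟨n, h⟩ := h
  rwa [h.len_eq]

/-- Finite sequences of ordinals compared first by length, then lexicographically. -/
def ShortLex (s t : M) : Prop :=
  len s ∈ᴹ len t ∨ (len s = len t ∧ ∃ i, i ∈ᴹ len s ∧ (∀ j, j ∈ᴹ i → app s j = app t j) ∧
    app s i ∈ᴹ app t i)

instance : DefRel₂ (ShortLex (M := M)) := ⟨by unfold ShortLex; infer_instance⟩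

theorem shortLex_linear {s t : M} (hs : IsFinOrdSeq s) (ht : IsFinOrdSeq t) :
    ShortLex s t ∨ s = t ∨ ShortLex t s := by
  have hs := hs.isOrdSeq
  have ht := ht.isOrdSeq
  rcases hs.1.1.trichotomy ht.1.1 with h | h | h
  · exact .inl (.inl h)
  · by_cases hex : ∃ i, i ∈ᴹ len s ∧ app s i ≠ app t i
    · obtain ⟨i, hi, hne⟩ := hex
      obtain ⟨i, -, ⟨hi, hne⟩, hmin⟩ := exists_least (P := fun i => i ∈ᴹ len s ∧ app s i ≠ app t i)
        (hs.1.1.mem hi) ⟨hi, hne⟩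
      have heq : ∀ j, j ∈ᴹ i → app s j = app t j := fun j hj => by
        by_contra hne'
        exact hmin j hj ⟨hs.1.1.trans hi hj, hne'⟩
      rcases (hs.isFun.2 i hi).2.trichotomy (ht.isFun.2 i (h ▸ hi)).2 with h' | h' | h'
      · exact .inl (.inr ⟨h, i, hi, heq, h'⟩)
      · exact absurd h' hne
      · exact .inr (.inr (.inr ⟨h.symm, i, h ▸ hi, fun j hj => (heq j hj).symm, h'⟩))
    · push Not at hex
      exact .inr (.inl (hs.ext (h ▸ ht) hex))
  · exact .inr (.inr (.inl h))

theorem ShortLex.trans {s t u : M} (hs : IsFinOrdSeq s) (ht : IsFinOrdSeq t) (hu : IsFinOrdSeq u)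
    (h : ShortLex s t) (h' : ShortLex t u) : ShortLex s u := by
  have hs := hs.isOrdSeq
  have ht := ht.isOrdSeq
  have hu := hu.isOrdSeq
  rcases h with h | ⟨e, i, hi, heq, hlt⟩
  · rcases h' with h' | ⟨e', -⟩
    · exact .inl (hu.1.1.trans h' h)
    · exact .inl (e' ▸ h)
  · rcases h' with h' | ⟨e', i', hi', heq', hlt'⟩
    · exact .inl (e ▸ h')
    · refine .inr ⟨e.trans e', ?_⟩
      rcases hs.1.1.2 i i' hi (e ▸ hi') with hii | rfl | hii
      · refine ⟨i, hi, fun j hj => (heq j hj).trans (heq' j ?_), heq' i hii ▸ hlt⟩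
        exact (hs.1.1.mem (e ▸ hi')).trans hii hj
      · exact ⟨i, hi, fun j hj => (heq j hj).trans (heq' j hj),
          (hu.isFun.2 i (e' ▸ e ▸ hi)).2.trans hlt' hlt⟩
      · refine ⟨i', e ▸ hi', fun j hj => (heq j ?_).trans (heq' j hj), (heq i' hii).symm ▸ hlt'⟩
        exact (hs.1.1.mem hi).trans hii hj

/-- In a nonempty set of sequences, among those of least length, initial segments are minimized
term by term. -/
theorem isWF_shortLex {T : M} (hT : ∀ t, t ∈ᴹ T → IsFinOrdSeq t) : IsWF T ShortLex := by
  refine ⟨fun s t u hs ht hu => ShortLex.trans (hT s hs) (hT t ht) (hT u hu), fun Y hY ⟨y, hy⟩ =>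
      ?_⟩
  have hseq : ∀ t, t ∈ᴹ Y → IsOrdSeq t (len t) := fun t ht => (hT t (hY t ht)).isOrdSeq
  obtain ⟨n, hno, ⟨y, hy, hyn⟩, hmin⟩ := exists_least (P := fun n => ∃ y, y ∈ᴹ Y ∧ len y = n)
    (hseq y hy).1.1 ⟨y, hy, rfl⟩
  have hn : IsNat n := hyn ▸ (hseq y hy).1
  -- A longest initial segment which is lexicographically minimal among those of the shortest
  -- elements.
  obtain ⟨k, ⟨hk, r, hr, hrn, hmn⟩, hmax⟩ := exists_greatest_nat (P := fun k => k ∈ᴹ succ n ∧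
    ∃ r, r ∈ᴹ Y ∧ len r = n ∧ ∀ z, z ∈ᴹ Y → len z = n → (∀ j, j ∈ᴹ k → app r j = app z j) ∨
      ∃ i, i ∈ᴹ k ∧ (∀ j, j ∈ᴹ i → app r j = app z j) ∧ app r i ∈ᴹ app z i) hn.succ
    (fun k hk => hk.1) ⟨emp, hno.succ.eq_emp_or.resolve_left (succ_ne_emp n), y, hy, hyn,
      fun z _ _ => .inl fun j hj => absurd hj (not_mem_emp j)⟩
  rcases mem_succ.1 hk with hkn | rfl
  · exfalso
    have hkv : ∀ z, z ∈ᴹ Y → len z = n → IsOrd (app z k) := fun z hz hzn =>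
      ((hseq z hz).isFun.2 k (hzn ▸ hkn)).2
    obtain ⟨v, hv, ⟨z, hz, hzn, hzr, rfl⟩, hvmin⟩ := exists_least (P := fun v => ∃ z, z ∈ᴹ Y ∧
        len z = n ∧
      (∀ j, j ∈ᴹ k → app r j = app z j) ∧ app z k = v) (hkv r hr hrn) ⟨r, hr, hrn, fun _ _ => rfl,
          rfl⟩
    have hsk : succ k ∈ᴹ succ n := (hno.succ.mem hk).succ.mem_succ_iff hno |>.2 fun t ht => by
      rcases mem_succ.1 ht with ht | rfl
      exacts [hno.trans hkn ht, hkn]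
    refine mem_irrefl k (hmax (succ k) ⟨hsk, z, hz, hzn, fun w hw hwn => ?_⟩ k (mem_succ_self k))
    rcases hmn w hw hwn with h | ⟨i, hi, h, hlt⟩
    · rcases hv.trichotomy (hkv w hw hwn) with h' | h' | h'
      · exact .inr ⟨k, mem_succ_self k, fun j hj => (hzr j hj).symm.trans (h j hj), h'⟩
      · left
        intro j hj
        rcases mem_succ.1 hj with hj | rfl
        exacts [(hzr j hj).symm.trans (h j hj), h']
      · exact absurd ⟨w, hw, hwn, h, rfl⟩ (hvmin _ h')
    · refine .inr ⟨i, mem_succ.2 (.inl hi), fun j hj => ?_, hzr i hi ▸ hlt⟩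
      rw [← hzr j ((hno.mem hkn).trans hi hj), h j hj]
  · refine ⟨r, hr, fun z hz hzr => ?_⟩
    rcases hzr with h | ⟨e, i, hi, heq, hlt⟩
    · exact hmin _ (hrn ▸ h) ⟨z, hz, rfl⟩
    · rw [hrn] at e
      rw [e] at hi
      rcases hmn z hz e with h | ⟨i', hi', h, hlt'⟩
      · rw [h i hi] at hlt
        exact mem_irrefl _ hlt
      · rcases hno.2 i i' hi hi' with h' | rfl | h'
        · rw [h i h'] at hlt
          exact mem_irrefl _ hlt
        · exact mem_asymm hlt hlt'
        · rw [heq i' h'] at hlt'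
          exact mem_irrefl _ hlt'

theorem CardLT.le_of_hartogs {B : M} (h : CardLT B (hartogs c)) : CardLE B c := by
  have hm := isOrd_hartogs c
  obtain ⟨a, ha, ham, hBa⟩ := h.1.exists_cardEq hm
  rcases (ha.incl_iff hm).1 ham with h1 | rfl
  · exact hBa.le.trans (cardLE_of_mem_hartogs h1)
  · exact absurd hBa h.2

/-- If `c⁺` is regular, then a tree of finite sequences of ordinals in which every node has at most
`c` immediate successors has at most `c` nodes. Otherwise the tree, being well-ordered by
`ShortLex`, has `c⁺` distinct nodes of the same length, and a longest node below `c⁺` many of them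
could still be extended. -/
theorem Reg.treeBound (hc : IsOrd c) (hω : Incl omega c) (hr : Reg (hartogs c)) :
    TreeBound (hartogs c) c := by
  intro T hT hbr
  have hm := isOrd_hartogs c
  by_contra hcon
  obtain ⟨a, F, ha, _, hF, surj, -, inj, -⟩ := exists_collapse (isWF_shortLex hT.1)
    fun x y hx hy => shortLex_linear (hT.1 x hx) (hT.1 y hy)
  have hma : Incl (hartogs c) a := (ha.not_mem_iff hm).1 fun h =>
    hcon ((CardLE.intro F hF inj).trans (cardLE_of_mem_hartogs h))
  have key : ∀ i, i ∈ᴹ a → ∃! t, t ∈ᴹ T ∧ i = F t := fun i hi => by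
    obtain ⟨t, ht, e⟩ := surj i hi
    exact ⟨t, ⟨ht, e⟩, fun s hs => inj s t hs.1 ht (hs.2.symm.trans e)⟩
  obtain ⟨E, _, hE, injE⟩ : ∃ E : M → M, DefFun₁ E ∧ (∀ i, i ∈ᴹ hartogs c → E i ∈ᴹ T) ∧
      ∀ i j, i ∈ᴹ hartogs c → j ∈ᴹ hartogs c → E i = E j → i = j :=
    ⟨fun i => the fun t => t ∈ᴹ T ∧ i = F t, inferInstance, fun i hi =>
        (the_spec (key i (hma i hi))).1,
      fun i j hi hj e => by
        beta_reduce at e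
        rw [(the_spec (key i (hma i hi))).2, e, ← (the_spec (key j (hma j hj))).2]⟩
  have hseq : ∀ i, i ∈ᴹ hartogs c → IsOrdSeq (E i) (len (E i)) := fun i hi =>
      (hT.1 _ (hE i hi)).isOrdSeq
  have hall : Unb (hartogs c) fun _ => True := fun x hx => ⟨x, hx, trivial, mem_irrefl x⟩
  obtain ⟨n, hn, hu⟩ := hall.pigeonhole hc hr (omega_le hω) (R := fun n i => len (E i) = n)
    fun i hi _ => ⟨_, mem_omega.2 (hseq i hi).1, rfl⟩
  rw [mem_omega] at hn
  have h0 : emp ∈ᴹ T := hT.2 _ emp (hE c (mem_hartogs_self hc)) ⟨emp, isOrdSeq_emp⟩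
    fun z hz => absurd hz (not_mem_emp z)
  have : DefRel₁ fun k => k ∈ᴹ succ n ∧ ∃ r, r ∈ᴹ T ∧ IsOrdSeq r k ∧
      Unb (hartogs c) fun i => len (E i) = n ∧ Incl r (E i) := by
    unfold Unb
    infer_instance
  obtain ⟨k, ⟨hk, r, hrT, hrk, hu⟩, hmax⟩ := exists_greatest_nat (P := fun k => k ∈ᴹ succ n ∧
    ∃ r, r ∈ᴹ T ∧ IsOrdSeq r k ∧ Unb (hartogs c) fun i => len (E i) = n ∧ Incl r (E i)) hn.succ
    (fun k hk => hk.1) ⟨emp, hn.1.succ.eq_emp_or.resolve_left (succ_ne_emp n), emp, h0,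
        isOrdSeq_emp,
      hu.mono fun i _ h => ⟨h.2, fun z hz => absurd hz (not_mem_emp z)⟩⟩
  rcases mem_succ.1 hk with hkn | rfl
  · obtain ⟨B, hB, hlt⟩ := hbr r hrT
    have hext : ∀ i, i ∈ᴹ hartogs c → len (E i) = n → Incl r (E i) →
        Incl (snoc r k (app (E i) k)) (E i) ∧ IsOrd (app (E i) k) := by
      intro i hi e h
      have hp := (hseq i hi).isFun.2 k (e ▸ hkn)
      refine ⟨fun p hp' => ?_, hp.2⟩
      rcases mem_snoc.1 hp' with hp' | rfl
      exacts [h p hp', hp.1]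
    obtain ⟨b, hb, hu'⟩ := hu.pigeonhole hc hr hlt.le_of_hartogs (R := fun b i => app (E i) k = b)
      fun i hi h => by
        have := hext i hi h.1 h.2
        exact ⟨_, (hB _).2 ⟨this.2, _, hT.2 _ _ (hE i hi) ⟨_, hrk.snoc this.2⟩ this.1,
          isAppend_iff.2 ⟨k, hrk, rfl⟩⟩, rfl⟩
    have hbo := ((hB b).1 hb).1
    have hu2 : Unb (hartogs c) fun i => len (E i) = n ∧ Incl (snoc r k b) (E i) :=
      hu'.mono fun i hi h => ⟨h.1.1, h.2 ▸ (hext i hi h.1.1 h.1.2).1⟩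
    obtain ⟨i, hi, h, -⟩ := hu2 c (mem_hartogs_self hc)
    have hsk : succ k ∈ᴹ succ n := (hrk.1.succ.1.mem_succ_iff hn.1).2 fun t ht => by
      rcases mem_succ.1 ht with ht | rfl
      exacts [hn.1.trans hkn ht, hkn]
    exact mem_irrefl k (hmax (succ k) ⟨hsk, _, hT.2 _ _ (hE i hi) ⟨_, hrk.snoc hbo⟩ h.2,
        hrk.snoc hbo, hu2⟩
      k (mem_succ_self k))
  · have heq : ∀ i, i ∈ᴹ hartogs c → len (E i) = k → Incl r (E i) → r = E i := fun i hi e h =>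
      hrk.ext (e ▸ hseq i hi) fun j hj => (hrk.app_eq_of_incl (hseq i hi) h hj).2
    obtain ⟨i, hi, h, -⟩ := hu c (mem_hartogs_self hc)
    obtain ⟨j, hj, h', hji⟩ := hu _ (succ_mem_hartogs hω hi)
    refine hji ?_
    rw [injE i j hi hj ((heq i hi h.1 h.2).symm.trans (heq j hj h'.1 h'.2))]
    exact mem_succ_self j

end Trees

section Partition

variable {M : Type u} [LSet.Structure M] [ZF M] {c : M}

/-! ### The partition relation -/

@[simp] theorem isOne_iff {i : M} : IsOne i ↔ i = succ emp := by simp [IsOne]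

theorem IsColoring.cases {f m : M} (hf : IsColoring f m) {x y : M} (hx : x ∈ᴹ m) (hy : y ∈ᴹ m)
    (hne : x ≠ y) : Maps f (upair x y) emp ∨ Maps f (upair x y) (succ emp) := by
  obtain ⟨D, C, hD, hC, hf⟩ := hf
  have hp : upair x y ∈ᴹ D := (hD _).2 ⟨x, y, hx, hy, hne, by simp⟩
  have h1 := hf.maps_iff.2 ⟨hp, rfl⟩
  have h2 := (hC _).1 (hf.app_mem hp)
  rw [isEmptySet_iff, isOne_iff] at h2
  rcases h2 with h | h
  exacts [.inl (h ▸ h1), .inr (h ▸ h1)]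

theorem isHomogeneous_iff {f H i : M} : IsHomogeneous f H i ↔
    ∀ x y, x ∈ᴹ H → y ∈ᴹ H → x ≠ y → Maps f (upair x y) i := by simp [IsHomogeneous]

theorem isHomogeneous_of_mem {f H i m : M} (hm : IsOrd m) (hH : Incl H m)
    (h : ∀ x y, x ∈ᴹ H → y ∈ᴹ H → x ∈ᴹ y → Maps f (upair x y) i) : IsHomogeneous f H i := by
  rw [isHomogeneous_iff]
  intro x y hx hy hne
  rcases hm.2 x y (hH x hx) (hH y hy) with h' | h' | h'
  · exact h x y hx hy h'
  · exact absurd h' hne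
  · rw [upair_comm]
    exact h y x hy hx h'

/-- The subset of the ordinal `a` formed by successively choosing every ordinal which satisfies `P`
and is `R`-above all ordinals chosen before. -/
theorem existsUnique_greedy {a : M} (ha : IsOrd a) {P : M → Prop} {R : M → M → Prop} [DefRel₁ P]
    [DefRel₂ R] : ∃! g, Incl g a ∧
      ∀ x, x ∈ᴹ a → (x ∈ᴹ g ↔ P x ∧ ∀ y, y ∈ᴹ g → y ∈ᴹ x → R y x) := by
  refine existsUnique_of_exists_of_unique ?_ fun g g' ⟨h1, h2⟩ ⟨h1', h2'⟩ => ?_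
  · obtain ⟨F, _, hF⟩ := ha.isWF.recursion fun x h => sep (upair x x) fun x =>
      P x ∧ ∀ y, y ∈ᴹ x → y ∈ᴹ app h y → R y x
    have hF' : ∀ x, x ∈ᴹ a → (x ∈ᴹ F x ↔ P x ∧ ∀ y, y ∈ᴹ x → y ∈ᴹ F y → R y x) := fun x hx => by
      rw [hF x hx, mem_sep]
      simp only [mem_upair, or_self, true_and]
      refine and_congr_right fun _ => forall_congr' fun y => imp_congr_right fun hy => ?_
      rw [app_lam (mem_sep.2 ⟨ha.trans hx hy, hy⟩)]
    refine ⟨sep a fun x => x ∈ᴹ F x, fun x hx => (mem_sep.1 hx).1, fun x hx => ?_⟩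
    simp only [mem_sep, hx, true_and, hF' x hx]
    refine and_congr_right fun _ => forall_congr' fun y => ⟨fun h h1 hy => h hy h1.2, fun h hy h1 =>
      h ⟨ha.trans hx hy, h1⟩ hy⟩
  · have key : ∀ x, x ∈ᴹ a → (x ∈ᴹ g ↔ x ∈ᴹ g') := by
      refine ha.isWF.induction fun x hx ih => ?_
      rw [h2 x hx, h2' x hx]
      refine and_congr_right fun _ => forall_congr' fun y => ?_
      exact ⟨fun h h1 hy => h ((ih y (ha.trans hx hy) hy).2 h1) hy,
        fun h h1 hy => h ((ih y (ha.trans hx hy) hy).1 h1) hy⟩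
    exact ext fun x => ⟨fun h => (key x (h1 x h)).1 h, fun h => (key x (h1' x h)).2 h⟩

/-- A nonempty set of ordinals contained in a set of finite order type has a greatest element. -/
theorem exists_greatest_of_orderType {g n z : M} (hn : IsNat n) (hg : HasOrderType g n)
    (hgo : ∀ x, x ∈ᴹ g → IsOrd x) (hz : Incl z g) (hne : ∃ x, x ∈ᴹ z) :
    ∃ x, x ∈ᴹ z ∧ ∀ y, y ∈ᴹ z → Incl y x := by
  obtain ⟨G, _, hG, mono, surj⟩ := hg.elim
  obtain ⟨k, ⟨hk, hkz⟩, hmax⟩ := exists_greatest_nat (P := fun k => k ∈ᴹ n ∧ G k ∈ᴹ z) hn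
    (fun k hk => hk.1) (by
      obtain ⟨x, hx⟩ := hne
      obtain ⟨k, hk, rfl⟩ := surj x (hz x hx)
      exact ⟨k, hk, hx⟩)
  refine ⟨G k, hkz, fun y hy => ?_⟩
  obtain ⟨l, hl, rfl⟩ := surj y (hz y hy)
  rw [(hgo _ (hG l hl)).incl_iff (hgo _ (hG k hk))]
  rcases ((hn.1.mem hl).incl_iff (hn.1.mem hk)).1 (hmax l ⟨hl, hy⟩) with h | rfl
  exacts [.inl (mono l k hl hk h), .inr rfl]

/-- On a regular successor cardinal, an assignment of a finite set of smaller ordinals to every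
ordinal is constant on an unbounded set. The greatest element can be made constant because it is a
regressive function; after that a counterexample would yield an infinite descending sequence of
ordinals. -/
theorem Reg.exists_unb_const (hc : IsOrd c) (hω : Incl omega c) (hr : Reg (hartogs c)) {G : M → M}
    [DefFun₁ G] (hG : ∀ a, a ∈ᴹ hartogs c → Incl (G a) a)
    (hfin : ∀ a, a ∈ᴹ hartogs c → ∃ n, IsNat n ∧ HasOrderType (G a) n) :
    ∃ r, Unb (hartogs c) fun a => G a = r := by
  have hm := isOrd_hartogs c
  have hGo : ∀ a, a ∈ᴹ hartogs c → ∀ x, x ∈ᴹ G a → IsOrd x := fun a ha x hx =>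
    (hm.mem ha).mem (hG a ha x hx)
  have hgr : ∀ a, a ∈ᴹ hartogs c → ∀ z, Incl z (G a) → z ≠ emp →
      ∃ x, x ∈ᴹ z ∧ ∀ y, y ∈ᴹ z → Incl y x := fun a ha z hz hne => by
    obtain ⟨n, hn, h⟩ := hfin a ha
    refine exists_greatest_of_orderType hn h (hGo a ha) hz ?_
    by_contra hcon
    push Not at hcon
    exact hne (ext fun t => iff_of_false (hcon t) (not_mem_emp t))
  obtain ⟨b, hb, hu⟩ := hr.exists_unb_fibre hc hω (F := fun a => sUnion (G a)) fun a ha hne => by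
    by_cases he : G a = emp
    · have : sUnion (G a) = emp := by rw [he]; ext z; simp
      rw [this]
      exact (hm.mem ha).eq_emp_or.resolve_left hne
    · obtain ⟨x, hx, hmax⟩ := hgr a ha (G a) (incl_refl _) he
      have : sUnion (G a) = x := ext fun z => by
        rw [mem_sUnion]
        exact ⟨fun ⟨y, hy, hzy⟩ => hmax y hy z hzy, fun hz => ⟨x, hx, hz⟩⟩
      rw [this]
      exact hG a ha x hx
  have : DefRel₁ fun x => x ∈ᴹ hartogs c ∧ ∃ r, Unb (hartogs c) fun a => diff (G a) x = r := by
    unfold Unb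
    infer_instance
  obtain ⟨x, hxo, ⟨hx, r, hu⟩, hmin⟩ := exists_least (P := fun x => x ∈ᴹ hartogs c ∧
    ∃ r, Unb (hartogs c) fun a => diff (G a) x = r) (hm.mem hb).succ ⟨succ_mem_hartogs hω hb, emp,
      hu.mono fun a ha e => ext fun z => by
        simp only [mem_diff, not_mem_emp, iff_false, not_and, not_not]
        intro hz
        rw [(hGo a ha z hz).mem_succ_iff (hm.mem hb), ← e]
        exact fun t ht => mem_sUnion.2 ⟨z, hz, ht⟩⟩
  rcases Unb.or hm (S := fun a => diff (G a) x = r ∧ sep (G a) (fun z => z ∈ᴹ x) = emp)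
    (T := fun a => diff (G a) x = r ∧ sep (G a) (fun z => z ∈ᴹ x) ≠ emp)
    (hu.mono fun a _ h => by tauto) with h | h
  · refine ⟨r, h.mono fun a _ ⟨h1, h2⟩ => ?_⟩
    rw [← h1]
    ext z
    rw [mem_diff, iff_self_and]
    intro hz hzx
    exact not_mem_emp z (h2 ▸ mem_sep.2 ⟨hz, hzx⟩)
  · exfalso
    obtain ⟨y, hy, hu'⟩ := h.pigeonhole hc hr (cardLE_of_mem_hartogs hx)
      (R := fun y a => y ∈ᴹ G a ∧ ∀ z, z ∈ᴹ G a → z ∈ᴹ x → Incl z y) fun a ha h => by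
        obtain ⟨y, hy, hmax⟩ := hgr a ha _ (fun z hz => (mem_sep.1 hz).1) h.2
        rw [mem_sep] at hy
        exact ⟨y, hy.2, hy.1, fun z hz hzx => hmax z (mem_sep.2 ⟨hz, hzx⟩)⟩
    refine hmin y hy ⟨hm.trans hx hy, union r (upair y y), hu'.mono fun a ha ⟨⟨h1, _⟩, h3, h4⟩ =>
        ?_⟩
    ext z
    simp only [← h1, mem_diff, mem_union, mem_upair, or_self]
    constructor
    · rintro ⟨hz, hzy⟩
      by_cases hzx : z ∈ᴹ x
      · rcases ((hGo a ha z hz).incl_iff (hxo.mem hy)).1 (h4 z hz hzx) with h | h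
        exacts [absurd h hzy, .inr h]
      · exact .inl ⟨hz, hzx⟩
    · rintro (⟨hz, hzx⟩ | rfl)
      · exact ⟨hz, fun h => hzx (hxo.trans hy h)⟩
      · exact ⟨h3, mem_irrefl z⟩

open Classical in
/-- If `c⁺` is regular then `c⁺ → (c⁺, ω + 1)²`. For every `a < c⁺` a set `G a ⊆ a` such that `G a
∪ {a}` is homogeneous in colour `1` is chosen greedily. If some `G a` is infinite, then it yields a
homogeneous set of type `ω + 1`; otherwise `G` is constant on an unbounded set, which is
homogeneous in colour `0`. -/
theorem Reg.arrow (hc : IsOrd c) (hω : Incl omega c) (hr : Reg (hartogs c)) :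
    Arrow (hartogs c) (hartogs c) (succ omega) := by
  intro f hf
  have hm := isOrd_hartogs c
  let G : M → M := fun a => the fun g => Incl g a ∧ ∀ x, x ∈ᴹ a → (x ∈ᴹ g ↔
    Maps f (upair x a) (succ emp) ∧ ∀ y, y ∈ᴹ g → y ∈ᴹ x → Maps f (upair y x) (succ emp))
  have dG : DefFun₁ G := by
    have : DefFun₁ fun a => the fun g => Incl g a ∧ ∀ x, x ∈ᴹ a → (x ∈ᴹ g ↔
      Maps f (upair x a) (succ emp) ∧ ∀ y, y ∈ᴹ g → y ∈ᴹ x → Maps f (upair y x) (succ emp)) :=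
      inferInstance
    exact this
  have hG : ∀ a, a ∈ᴹ hartogs c → Incl (G a) a ∧ ∀ x, x ∈ᴹ a → (x ∈ᴹ G a ↔
      Maps f (upair x a) (succ emp) ∧ ∀ y, y ∈ᴹ G a → y ∈ᴹ x → Maps f (upair y x) (succ emp)) :=
    fun a ha => the_spec (P := fun g => Incl g a ∧ ∀ x, x ∈ᴹ a → (x ∈ᴹ g ↔
      Maps f (upair x a) (succ emp) ∧ ∀ y, y ∈ᴹ g → y ∈ᴹ x → Maps f (upair y x) (succ emp)))
      (existsUnique_greedy (P := fun x => Maps f (upair x a) (succ emp))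
        (R := fun y x => Maps f (upair y x) (succ emp)) (hm.mem ha))
  by_cases hfin : ∀ a, a ∈ᴹ hartogs c → ∃ n, IsNat n ∧ HasOrderType (G a) n
  · obtain ⟨r, hu⟩ := hr.exists_unb_const hc hω (fun a ha => (hG a ha).1) hfin
    have hH : Incl (sep (hartogs c) fun a => G a = r) (hartogs c) := fun a ha => (mem_sep.1 ha).1
    refine ⟨sep (hartogs c) fun a => G a = r, hH, .inl
      ⟨Unb.hasOrderType hm hr hH (hu.mono fun a ha e => mem_sep.2 ⟨ha, e⟩), emp, by simp,
        isHomogeneous_of_mem hm hH fun a b ha hb hab => ?_⟩⟩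
    rw [mem_sep] at ha hb
    refine (hf.cases ha.1 hb.1 (ne_of_mem hab)).resolve_right fun h1 => ?_
    have : a ∈ᴹ G b := ((hG b hb.1).2 a hab).2 ⟨h1, fun y hy _ => by
      rw [hb.2, ← ha.2] at hy
      exact (((hG a ha.1).2 y ((hG a ha.1).1 y hy)).1 hy).1⟩
    rw [hb.2, ← ha.2] at this
    exact mem_irrefl a ((hG a ha.1).1 a this)
  · push Not at hfin
    obtain ⟨a, ha, hfin⟩ := hfin
    obtain ⟨t, ht, -, hot⟩ := exists_orderType (hm.mem ha) (hG a ha).1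
    have hωt : Incl omega t := (ht.not_mem_iff isOrd_omega).1 fun h => hfin t (mem_omega.1 h) hot
    obtain ⟨g, _, hg, mono, -⟩ := hot.elim
    have hgG : ∀ i, i ∈ᴹ omega → g i ∈ᴹ G a := fun i hi => hg i (hωt i hi)
    have hH : ∀ x, x ∈ᴹ union (image omega g) (upair a a) ↔ (∃ i, i ∈ᴹ omega ∧ x = g i) ∨ x = a :=
      fun x => by simp only [mem_union, mem_image, mem_upair, or_self]
    have hHm : Incl (union (image omega g) (upair a a)) (hartogs c) := fun x hx => by
      rcases (hH x).1 hx with ⟨i, hi, rfl⟩ | rfl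
      exacts [hm.trans ha ((hG a ha).1 _ (hgG i hi)), ha]
    refine ⟨union (image omega g) (upair a a), hHm, .inr ⟨.intro isOrd_omega.succ
      (fun i => if i = omega then a else g i) (fun i hi => ?_) (fun i j hi hj hij => ?_) fun x hx =>
          ?_,
      succ emp, by simp, isHomogeneous_of_mem hm hHm fun x y hx hy hxy => ?_⟩⟩
    · rw [hH]
      split_ifs with h
      exacts [.inr rfl, .inl ⟨i, (mem_succ.1 hi).resolve_right h, rfl⟩]
    · have hiω : i ∈ᴹ omega := by
        rcases mem_succ.1 hj with h | rfl
        exacts [isOrd_omega.trans h hij, hij]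
      rw [if_neg (ne_of_mem hiω)]
      split_ifs with h
      · exact (hG a ha).1 _ (hgG i hiω)
      · exact mono i j (hωt i hiω) (hωt j ((mem_succ.1 hj).resolve_right h)) hij
    · rcases (hH x).1 hx with ⟨i, hi, rfl⟩ | rfl
      · exact ⟨i, mem_succ.2 (.inl hi), by rw [if_neg (ne_of_mem hi)]⟩
      · exact ⟨omega, mem_succ_self _, by rw [if_pos rfl]⟩
    · have hxG : x ∈ᴹ G a := by
        rcases (hH x).1 hx with ⟨i, hi, rfl⟩ | rfl
        · exact hgG i hi
        · rcases (hH y).1 hy with ⟨i, hi, rfl⟩ | rfl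
          · exact absurd ((hG x ha).1 _ (hgG i hi)) (mem_asymm hxy)
          · exact absurd hxy (mem_irrefl _)
      rcases (hH y).1 hy with ⟨i, hi, rfl⟩ | rfl
      · exact (((hG a ha).2 _ ((hG a ha).1 _ (hgG i hi))).1 (hgG i hi)).2 x hxG hxy
      · exact (((hG y ha).2 _ hxy).1 hxG).1

open Classical in
/-- If `cf(c⁺) ≤ ω`, then colouring a pair by whether its two elements have distinct indices in a
cofinal sequence of type `ω` refutes `c⁺ → (c⁺, ω + 1)²`. -/
theorem Arrow.not_hasCofinalMap (hω : Incl omega c)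
    (h : Arrow (hartogs c) (hartogs c) (succ omega)) : ¬ HasCofinalMap (hartogs c) omega := by
  intro hcof
  have hm := isOrd_hartogs c
  obtain ⟨I, _, hI, hmono, hb⟩ := hcof.exists_index hm isOrd_omega fun x hx =>
      succ_mem_hartogs hω hx
  let D : M := sep (power (hartogs c)) fun p => ∃ x y, x ∈ᴹ hartogs c ∧ y ∈ᴹ hartogs c ∧ x ≠ y ∧
    p = upair x y
  have hD : ∀ p, p ∈ᴹ D ↔ ∃ x y, x ∈ᴹ hartogs c ∧ y ∈ᴹ hartogs c ∧ x ≠ y ∧ p = upair x y := fun p =>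
      by
    simp only [D, mem_sep, and_iff_right_iff_imp, mem_power]
    rintro ⟨x, y, hx, hy, -, rfl⟩ z hz
    rcases mem_upair.1 hz with rfl | rfl
    exacts [hx, hy]
  obtain ⟨H, hH, hhom⟩ := h (lam D fun p => if ∃ x y, p = upair x y ∧
      I x ≠ I y then succ emp else emp)
    ⟨D, upair emp (succ emp), fun p => by simp [hD], fun i => by simp, isFun_lam fun p _ => by
      split_ifs <;> simp⟩
  rcases hhom with ⟨hot, i, hi, hhom⟩ | ⟨hot, i, hi, hhom⟩
  · rw [isEmptySet_iff] at hi
    subst hi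
    rw [isHomogeneous_iff] at hhom
    have hu := unb_of_cardLE hH hot.cardEq.le
    obtain ⟨a, ha, haH, -⟩ := hu omega (mem_hartogs.2 ⟨isOrd_omega, omega_le hω⟩)
    obtain ⟨x, hx, hxa⟩ := hb (I a) (hI a ha)
    obtain ⟨y, hy, hyH, hyx⟩ := hu x hx
    by_cases hya : y = a
    · exact hyx (hxa y hy (hya ▸ rfl))
    · have := (maps_lam.1 (hhom y a hyH haH hya)).2
      split_ifs at this with h'
      · exact succ_ne_emp _ this.symm
      · push Not at h'
        exact hyx (hxa y hy (h' y a rfl))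
  · rw [isOne_iff] at hi
    subst hi
    rw [isHomogeneous_iff] at hhom
    have hne : ∀ x y, x ∈ᴹ H → y ∈ᴹ H → x ∈ᴹ y → I x ∈ᴹ I y := fun x y hx hy hxy => by
      refine (isOrd_omega.mem (hI x (hH x hx))).mem_of_incl_ne (isOrd_omega.mem (hI y (hH y hy)))
        (hmono x y (hH x hx) (hH y hy) hxy) ?_
      have := (maps_lam.1 (hhom x y hx hy (ne_of_mem hxy))).2
      split_ifs at this with h'
      · obtain ⟨x', y', e, hne⟩ := h'
        rcases upair_eq_iff.1 e with ⟨rfl, rfl⟩ | ⟨rfl, rfl⟩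
        exacts [hne, hne.symm]
      · exact absurd this (succ_ne_emp _)
    obtain ⟨g, _, hg, mono, -⟩ := hot.elim
    have hs : ∀ i, i ∈ᴹ omega → i ∈ᴹ succ (omega : M) := fun i hi => mem_succ.2 (.inl hi)
    have hn := hI _ (hH _ (hg _ (mem_succ_self omega)))
    have := isOrd_omega.incl_of_increasing (F := fun i => I (g i))
      (fun i hi => isOrd_omega.mem (hI _ (hH _ (hg i (hs i hi)))))
      (fun i j hi hj hij =>
          hne _ _ (hg i (hs i hi)) (hg j (hs j hj)) (mono i j (hs i hi) (hs j hj) hij))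
      _ hn
    exact mem_irrefl _ (this _ (hne _ _ (hg _ (hs _ hn)) (hg _ (mem_succ_self _))
      (mono _ _ (hs _ hn) (mem_succ_self _) hn)))

theorem exists_isCof {m : M} (hm : IsOrd m) : ∃ t, IsCof m t := by
  have h : HasCofinalMap m m := ⟨lam m fun x => x, isFun_lam fun _ h => h, fun x hx =>
    ⟨x, x, by simp [hx], .inl rfl⟩⟩
  obtain ⟨t, ht, htc, hmin⟩ := exists_least (P := HasCofinalMap m) hm h
  exact ⟨t, ht, htc, hmin⟩

theorem Arrow.omega_mem_cof (hω : Incl omega c) (h : Arrow (hartogs c) (hartogs c) (succ omega)) :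
    ∃ t, IsCof (hartogs c) t ∧ omega ∈ᴹ t := by
  obtain ⟨t, ht⟩ := exists_isCof (isOrd_hartogs c)
  refine ⟨t, ht, ?_⟩
  by_contra hcon
  exact h.not_hasCofinalMap hω (ht.2.1.of_cardLE emp_mem_hartogs
    (.of_incl ((isOrd_omega.not_mem_iff ht.1).1 hcon)))

/-- If `cf(ω₁) > ω` then `ω₁` is regular. -/
theorem reg_of_omega_mem_cof {t : M} (ht : IsCof (hartogs omega) t) (hωt : omega ∈ᴹ t) :
    Reg (hartogs (omega : M)) := fun _ hd hcof =>
  ht.2.2 omega hωt (hcof.of_cardLE emp_mem_hartogs (cardLE_of_mem_hartogs hd))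

end Partition

end ZFModel

theorem mainTheorem2 {M : Type*} [ZFModel.LSet.Structure M] (hM : ZFModel.ModelsZF M)
    (κ : M) (hκ : ZFModel.IsInfCard κ) :
    -- `w = ω`, `w' = ω + 1` and `μ = κ⁺`
    ∃ w w' μ : M, ZFModel.IsOmega w ∧ ZFModel.IsSucc w w' ∧ ZFModel.IsSuccCard κ μ ∧
      List.TFAE [ZFModel.IsCof μ μ, ZFModel.TreeBound μ κ, ZFModel.Regressive μ μ,
        ZFModel.DeltaArrow μ μ] ∧
      (ZFModel.IsCof μ μ → ZFModel.Arrow μ μ w') ∧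
      (ZFModel.Arrow μ μ w' → ∃ θ : M, ZFModel.IsCof μ θ ∧ ZFModel.Mem w θ) ∧
      (κ = w → List.TFAE [ZFModel.IsCof μ μ, ZFModel.Arrow μ μ w', ZFModel.Regressive μ μ,
        ZFModel.DeltaArrow μ μ]) := by
  have : ZFModel.ZF M := ⟨hM⟩
  have hc : ZFModel.IsOrd κ := hκ.1.1
  have hω := hκ.omega_incl
  refine ⟨ZFModel.omega, ZFModel.succ ZFModel.omega, ZFModel.hartogs κ, fun n => ZFModel.mem_omega,
    ZFModel.isSucc_iff.2 rfl, ZFModel.isSuccCard_hartogs hc, ?_, ?_, ?_, ?_⟩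
  · rw [ZFModel.isCof_self_iff (ZFModel.isOrd_hartogs κ)]
    tfae_have 1 → 2 := fun h => h.treeBound hc hω
    tfae_have 2 → 1 := fun h => h.reg hω
    tfae_have 1 → 3 := fun h => h.regressive hc hω
    tfae_have 3 → 1 := fun h => h.reg hω
    tfae_have 1 → 4 := fun h => h.deltaArrow hc hω
    tfae_have 4 → 1 := fun h => h.reg hω
    tfae_finish
  · rw [ZFModel.isCof_self_iff (ZFModel.isOrd_hartogs κ)]
    exact fun h => h.arrow hc hω
  · exact fun h => h.omega_mem_cof hω
  · intro e
    rw [ZFModel.isCof_self_iff (ZFModel.isOrd_hartogs κ)]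
    tfae_have 1 → 2 := fun h => h.arrow hc hω
    tfae_have 2 → 1 := fun h => by
      obtain ⟨t, ht, hωt⟩ := h.omega_mem_cof hω
      rw [e] at ht ⊢
      exact ZFModel.reg_of_omega_mem_cof ht hωt
    tfae_have 1 → 3 := fun h => h.regressive hc hω
    tfae_have 3 → 1 := fun h => h.reg hω
    tfae_have 1 → 4 := fun h => h.deltaArrow hc hω
    tfae_have 4 → 1 := fun h => h.reg hω
    tfae_finish
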